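/- **Theorem 3.1.** Let $\mathcal V$ be the set of all finite words over $\{0,1,2,\dots\}$, including the empty word $o$ (the root); the children of $v\in\mathcal V$ are $(v,0),(v,1),(v,2),\dots$. A *rooted ordered tree* is a set $T\subseteq\mathcal V$ with $o\in T$, such that $(v,i)\in T$ implies $v\in T$, and $(v,i+1)\in T$ implies $(v,i)\in T$. Its size $|T|$ is its number of vertices. Random trees are random elements of $\{0,1\}^{\mathcal V}$ with the product $\sigma$-algebra. For $1\le k<\infty$ let $\mathcal T_k$ be the uniform distribution on the (finitely many) rooted ordered trees of size $k$. *The law $\mathcal T_\infty(1/2)$.* There is a coupling $(T_k)_{k\ge1}$ with $T_k\sim\mathcal T_k$ for every $k$ and $T_1\subseteq T_2\subseteq\cdots$ almost surely (Luczak–Winkler); $\mathcal T_\infty(1/2)$ denotes the law of $\bigcup_{k\ge1}T_k$ for such a coupling. *The law $\mathcal T_\infty(p)$, $1/2<p\le1$.* For $1/2<p<1$ let $(X_v)_{v\in\mathcal V}$ be i.i.d. with $\mathbb P(X_v=k)=p^k(1-p)$, $k=0,1,2,\dots$; put $V_0=\{o\}$, $V_{n+1}=\{(v,i): v\in V_n,\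 0\le i<X_v\}$ and $T(p)=\bigcup_{n\ge0}V_n$. Then $\mathcal T_\infty(p)$ is the law of $T(p)$ conditioned on $|T(p)|=\infty$. For $p=1$ every vertex has infinitely many children, and $\mathcal T_\infty(1)$ is the point mass at $\mathcal V$. Then such increasing couplings $(T_k)_{k\ge 1}$ exist, so that $\mathcal T_\infty(1/2)$ is defined; and for every $p$ with $1/2<p\le1$ and every such coupling used to define $\mathcal T_\infty(1/2)$, there exist random trees $T_\infty(1/2)\sim\mathcal T_\infty(1/2)$ and $T_\infty(p)\sim\mathcal T_\infty(p)$ on a common probability space such that $$\mathbb P\bigl(T_\infty(1/2)\subseteq T_\infty(p)\bigr)=1 .$$ -/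

import Mathlib

open MeasureTheory ProbabilityTheory

namespace GeomTree

/-- Vertices of the Ulam–Harris tree: finite words, `[]` is the root `o`, and the children of `v`
are `v ++ [0], v ++ [1], …` in order of birth (children are labelled from `0` rather than from
`1`). Sets of vertices carry the product σ-algebra of `{0,1}^Vertex`
(Mathlib's `Set.instMeasurableSpace`). -/
abbrev Vertex : Type := List ℕ

/-- The rooted ordered trees: vertex sets containing the root which are closed under taking the
parent (for a set containing the root this is connectedness of the induced graph) and
under taking the youngest older sibling. -/
structure IsPlaneTree (T : Set Vertex) : Prop where
  root_mem : [] ∈ T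
  parent_mem : ∀ (v : Vertex) (i : ℕ), v ++ [i] ∈ T → v ∈ T
  sibling_mem : ∀ (v : Vertex) (i : ℕ), v ++ [i + 1] ∈ T → v ++ [i] ∈ T

/-- The rooted ordered trees with exactly `k` vertices. -/
def planeTreesOfSize (k : ℕ) : Set (Set Vertex) :=
  {T | IsPlaneTree T ∧ T.encard = k}

/-- The law of a uniformly chosen rooted ordered tree with `k` vertices (for `k ≥ 1`). -/
noncomputable def uniformTreeLaw (k : ℕ) : Measure (Set Vertex) :=
  uniformOn (planeTreesOfSize k)

/-- `T k`, `k ≥ 1`, are random trees on `(Ω, P)`, `T k` uniform among the rooted ordered trees of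
size `k`, with `T 1 ⊆ T 2 ⊆ ⋯` almost surely. The value of `T 0` is irrelevant. -/
structure IsIncreasingUniformCoupling {Ω : Type*} [MeasurableSpace Ω] (P : Measure Ω)
    (T : ℕ → Ω → Set Vertex) : Prop where
  isProbabilityMeasure : IsProbabilityMeasure P
  hasLaw : ∀ k : ℕ, 1 ≤ k → HasLaw (T k) (uniformTreeLaw k) P
  subset_succ : ∀ᵐ ω ∂P, ∀ k : ℕ, 1 ≤ k → T k ω ⊆ T (k + 1) ω

/-- `ν` is the law of `T_∞(1/2) = ⋃_{k ≥ 1} T_k`, for an increasing coupling `(T_k)_{k ≥ 1}` of the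
uniform rooted ordered trees of size `k`. -/
def IsCriticalInfiniteTreeLaw (ν : Measure (Set Vertex)) : Prop :=
  ∃ (Ω : Type) (_ : MeasurableSpace Ω) (P : Measure Ω) (T : ℕ → Ω → Set Vertex),
    IsIncreasingUniformCoupling P T ∧ HasLaw (fun ω => ⋃ k : ℕ, ⋃ _ : 1 ≤ k, T k ω) ν P

/-- The geometric offspring law: mass `p ^ k * (1 - p)` at `k = 0, 1, 2, …`
(a probability measure for `0 ≤ p < 1`). -/
noncomputable def offspringLaw (p : ℝ) : Measure ℕ :=
  Measure.sum fun k : ℕ => ENNReal.ofReal (p ^ k * (1 - p)) • Measure.dirac k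

/-- The `n`-th generation of the tree in which the vertex `v` has `X v` children. -/
def generation (X : Vertex → ℕ) : ℕ → Set Vertex
  | 0 => {[]}
  | n + 1 => {w | ∃ v ∈ generation X n, ∃ i < X v, w = v ++ [i]}

/-- The tree in which the vertex `v` has `X v` children. -/
def familyTree (X : Vertex → ℕ) : Set Vertex := ⋃ n : ℕ, generation X n

theorem measurableSet_mem_generation (n : ℕ) (w : Vertex) :
    MeasurableSet {X : Vertex → ℕ | w ∈ generation X n} := by
  induction n generalizing w with
  | zero => exact MeasurableSet.const _
  | succ n ih =>
    have h : {X : Vertex → ℕ | w ∈ generation X (n + 1)} =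
        ⋃ v : Vertex, ⋃ i : ℕ, {X : Vertex → ℕ | v ∈ generation X n} ∩
          ((fun X : Vertex → ℕ => X v) ⁻¹' {m | i < m} ∩ {_X | w = v ++ [i]}) := by
      ext X
      simp [generation]
    rw [h]
    exact MeasurableSet.iUnion fun v => MeasurableSet.iUnion fun i =>
      (ih v).inter (((measurable_pi_apply v) (MeasurableSet.of_discrete)).inter
        (MeasurableSet.const _))

theorem measurable_familyTree : Measurable familyTree := by
  rw [measurable_set_iff]
  intro w
  refine measurableSet_setOfPred.mp ?_
  have h : {X : Vertex → ℕ | w ∈ familyTree X} = ⋃ n, {X | w ∈ generation X n} := by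
    ext X
    simp [familyTree]
  rw [h]
  exact MeasurableSet.iUnion fun n => measurableSet_mem_generation n w

/-- The law of the Galton–Watson tree `T(p)`, `0 < p < 1`: the family tree of i.i.d. geometric
numbers of children `X v`, `v` a vertex. -/
noncomputable def galtonWatsonLaw (p : ℝ) : Measure (Set Vertex) :=
  (Measure.infinitePi fun _ : Vertex => offspringLaw p).map familyTree

/-- The law of `T_∞(p)`, `1/2 < p ≤ 1`. For `p < 1` it is the law of the Galton–Watson tree `T(p)`
conditioned on being infinite. For `p = 1` the number of children is almost surely
infinite, so that the tree consists of all vertices. -/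
noncomputable def supercriticalInfiniteTreeLaw (p : ℝ) : Measure (Set Vertex) :=
  if p = 1 then Measure.dirac Set.univ
  else ProbabilityTheory.cond (galtonWatsonLaw p) {T | T.Infinite}

end GeomTree

namespace GeomTree

/-! The first-child/next-sibling coding (`toVertex`, `planeTree`) turns rooted ordered trees with n
+ 1 vertices into binary trees with n nodes and preserves inclusion. It therefore suffices to work
inside the infinite binary tree, where a random tree splits at its root into two subtrees that are
independent given their sizes.

Attach an independent uniform u to every node. In a tree with r ≤ ⊤ nodes, let the left subtree size
be a quantile at u and the right one the same quantile at 1 - u; for finite r the two sizes fit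
together because the split law is symmetric (`splitCdf_coe_add`). The distribution functions
decrease in r (`splitCdf_antitone`), since ratios of consecutive Catalan numbers increase and are at
most 4, while p(1 - p) ≤ 1/4. Hence both subtree sizes, and recursively the whole tree, increase
with r for a fixed environment (`rankTree_mono`): one environment couples all sizes, including ⊤.

It remains to identify laws. For finite r, the Catalan recursion makes the tree uniform
(`map_rankPlaneTree`). For r = ⊤, mixing over r with the size law of binary percolation gives a tree
containing a given t with probability p ^ |t| (`tsum_sizeMass_mul_binaryEnvLaw`). The Galton–Watson
tree has the same containment probabilities, because ℙ(X_v ≥ m) = p ^ m; so it is the same mixture,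
and conditioning on being infinite selects r = ⊤ (`map_rankPlaneTree_top`).

Finally, the law of the union does not depend on the increasing coupling
(`IsCriticalInfiniteTreeLaw.unique`), so the union of the trees built here has the prescribed law,
and it lies in the tree for r = ⊤. For p = 1 the larger tree is everything. -/

/-! ### Catalan numbers and their generating function -/

theorem add_two_mul_catalan_succ (n : ℕ) :
    (n + 2) * catalan (n + 1) = 2 * (2 * n + 1) * catalan n := by
  have h1 := succ_mul_catalan_eq_centralBinom n
  have h2 := succ_mul_catalan_eq_centralBinom (n + 1)
  have h3 := Nat.succ_mul_centralBinom_succ n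
  rw [← h1, ← h2] at h3
  apply Nat.eq_of_mul_eq_mul_left (Nat.succ_pos n)
  rw [Nat.succ_eq_add_one]
  linarith

theorem catalan_pos (n : ℕ) : 0 < catalan n := by
  have h := succ_mul_catalan_eq_centralBinom n
  have := Nat.centralBinom_pos n
  exact Nat.pos_of_mul_pos_left (h ▸ this)

theorem catalan_succ_le_four_mul (n : ℕ) : catalan (n + 1) ≤ 4 * catalan n := by
  have h := add_two_mul_catalan_succ n
  nlinarith

/-- The ratios of consecutive Catalan numbers increase. -/
theorem catalan_succ_mul_catalan_le {m n : ℕ} (h : m ≤ n) :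
    catalan (m + 1) * catalan n ≤ catalan m * catalan (n + 1) := by
  have h1 := add_two_mul_catalan_succ m
  have h2 := add_two_mul_catalan_succ n
  have hpos : 0 < (m + 2) * (n + 2) := by positivity
  refine Nat.le_of_mul_le_mul_left ?_ hpos
  calc (m + 2) * (n + 2) * (catalan (m + 1) * catalan n)
      = ((m + 2) * catalan (m + 1)) * (n + 2) * catalan n := by ring
    _ = (2 * (2 * m + 1) * (n + 2)) * (catalan m * catalan n) := by rw [h1]; ring
    _ ≤ (2 * (2 * n + 1) * (m + 2)) * (catalan m * catalan n) := by
        refine Nat.mul_le_mul_right _ ?_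
        nlinarith
    _ = (m + 2) * catalan m * ((n + 2) * catalan (n + 1)) := by rw [h2]; ring
    _ = _ := by ring

theorem catalan_add_le (m i : ℕ) : catalan (m + i) ≤ 4 ^ i * catalan m := by
  induction i with
  | zero => simp
  | succ i ih =>
    calc catalan (m + i + 1) ≤ 4 * catalan (m + i) := catalan_succ_le_four_mul _
      _ ≤ 4 * (4 ^ i * catalan m) := by gcongr
      _ = _ := by ring

theorem sum_antidiagonal_catalan_mul_pow (x : ℝ) (n : ℕ) :
    ∑ ij ∈ Finset.HasAntidiagonal.antidiagonal n, ((catalan ij.1 : ℝ) * x ^ ij.1) * (catalan ij.2 * x ^ ij.2) =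
      catalan (n + 1) * x ^ n := by
  rw [catalan_succ', Nat.cast_sum, Finset.sum_mul]
  refine Finset.sum_congr rfl fun ij hij => ?_
  rw [← Finset.HasAntidiagonal.mem_antidiagonal.1 hij, pow_add]
  push_cast
  ring

/-- By the Catalan recursion the partial sums satisfy S_{n+1} ≤ 1 + x S_n² with x = p(1 - p), and
1/p is a fixed point of s ↦ 1 + x s². -/
theorem sum_range_catalan_mul_pow_le {p : ℝ} (hp : 0 < p) (hp1 : p ≤ 1) (n : ℕ) :
    ∑ j ∈ Finset.range n, (catalan j : ℝ) * (p * (1 - p)) ^ j ≤ 1 / p := by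
  have hx : 0 ≤ p * (1 - p) := mul_nonneg hp.le (by linarith)
  induction n with
  | zero => simpa using hp.le
  | succ n ih =>
    rw [Finset.sum_range_succ']
    set S := ∑ j ∈ Finset.range n, (catalan j : ℝ) * (p * (1 - p)) ^ j with hS
    have hS0 : 0 ≤ S := Finset.sum_nonneg fun j _ => by positivity
    -- The antidiagonals of index below n are disjoint and lie in the square `range n × range n`;
    -- the other terms of S * S are nonnegative.
    have key : ∑ j ∈ Finset.range n, (catalan (j + 1) : ℝ) * (p * (1 - p)) ^ j ≤ S * S := by
      rw [hS, Finset.sum_mul_sum, ← Finset.sum_product']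
      simp_rw [← sum_antidiagonal_catalan_mul_pow]
      rw [Finset.sum_sigma']
      rw [← Finset.sum_image (g := fun a : (_ : ℕ) × (ℕ × ℕ) => a.2)
        (f := fun ij : ℕ × ℕ => ((catalan ij.1 : ℝ) * (p * (1 - p)) ^ ij.1) *
          (catalan ij.2 * (p * (1 - p)) ^ ij.2))]
      · refine Finset.sum_le_sum_of_subset_of_nonneg ?_ fun ij _ _ => by positivity
        intro ij hij
        simp only [Finset.mem_image, Finset.mem_sigma, Finset.mem_range, Finset.HasAntidiagonal.mem_antidiagonal,
          Finset.mem_product] at hij ⊢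
        obtain ⟨a, ⟨h1, h2⟩, rfl⟩ := hij
        omega
      · rintro ⟨a, b⟩ ha ⟨a', b'⟩ ha' h
        simp only [Finset.coe_sigma, Set.mem_sigma_iff, Finset.mem_coe, Finset.mem_range,
          Finset.HasAntidiagonal.mem_antidiagonal] at ha ha' h
        subst h
        obtain ⟨_, rfl⟩ := ha
        obtain ⟨_, rfl⟩ := ha'
        rfl
    have h2 : ∑ j ∈ Finset.range n, (catalan (j + 1) : ℝ) * (p * (1 - p)) ^ (j + 1) ≤
        p * (1 - p) * (S * S) := by
      refine le_trans (le_of_eq ?_) (mul_le_mul_of_nonneg_left key hx)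
      rw [Finset.mul_sum]
      exact Finset.sum_congr rfl fun j _ => by ring
    have h3 : p * (1 - p) * (S * S) ≤ p * (1 - p) * (1 / p * (1 / p)) := by gcongr
    have h4 : p * (1 - p) * (1 / p * (1 / p)) + 1 = 1 / p := by field_simp; ring
    simp only [catalan_zero, Nat.cast_one, pow_zero, mul_one]
    linarith

/-- The generating function of the Catalan numbers at `p * (1 - p)`, `1 / 2 < p ≤ 1`. -/
theorem hasSum_catalan_mul_pow {p : ℝ} (hp : 1 / 2 < p) (hp1 : p ≤ 1) :
    HasSum (fun j : ℕ => (catalan j : ℝ) * (p * (1 - p)) ^ j) (1 / p) := by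
  have hp0 : 0 < p := by linarith
  have hx : 0 ≤ p * (1 - p) := mul_nonneg hp0.le (by linarith)
  set f : ℕ → ℝ := fun j => (catalan j : ℝ) * (p * (1 - p)) ^ j with hf
  have hf0 : ∀ j, 0 ≤ f j := fun j => by positivity
  have hs : Summable f :=
    summable_of_sum_range_le hf0 fun n => sum_range_catalan_mul_pow_le hp0 hp1 n
  have hle : ∑' j, f j ≤ 1 / p :=
    hs.tsum_le_of_sum_range_le fun n => sum_range_catalan_mul_pow_le hp0 hp1 n
  have hn : Summable fun j => ‖f j‖ := hs.norm
  have hsq := tsum_mul_tsum_eq_tsum_sum_antidiagonal_of_summable_norm hn hn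
  have heq : ∑' j, f j = 1 + p * (1 - p) * ((∑' j, f j) * ∑' j, f j) := by
    rw [hsq, ← tsum_mul_left, hs.tsum_eq_zero_add]
    congr 1
    · simp [hf]
    · refine tsum_congr fun n => ?_
      rw [hf]
      dsimp only
      rw [sum_antidiagonal_catalan_mul_pow]
      ring
  -- The quadratic s = 1 + p(1 - p)s² has roots 1/p and 1/(1 - p); the bound s ≤ 1/p and p > 1/2
  -- exclude the second.
  have hfac : (p * (∑' j, f j) - 1) * ((1 - p) * (∑' j, f j) - 1) = 0 := by
    linear_combination -heq
  have hlt : (1 - p) * (∑' j, f j) - 1 < 0 := by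
    have : (1 - p) * (∑' j, f j) ≤ (1 - p) * (1 / p) := by gcongr
    have h2 : (1 - p) * (1 / p) < 1 := by
      rw [mul_one_div, div_lt_one hp0]; linarith
    linarith
  have : p * (∑' j, f j) - 1 = 0 := (mul_eq_zero.1 hfac).resolve_right hlt.ne
  have h3 : ∑' j, f j = 1 / p := by field_simp; linarith
  exact h3 ▸ hs.hasSum

/-! ### Monotonicity of the split of a binary tree at its root -/

/-- The mass that the law of the size of the left subtree of a binary tree gives to `j`. The tree
has `m + 1` nodes and is uniform for `m < ⊤`; for `m = ⊤` and `x = p * (1 - p)` it is a binary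
percolation tree with parameter `p` conditioned to be infinite. -/
noncomputable def splitMass (x : ℝ) : ℕ∞ → ℕ → ℝ
  | none, j => catalan j * x ^ (j + 1)
  | some n, j => if j ≤ n then catalan j * catalan (n - j) / catalan (n + 1) else 0

theorem splitMass_top (x : ℝ) (j : ℕ) : splitMass x ⊤ j = catalan j * x ^ (j + 1) := rfl

theorem splitMass_coe (x : ℝ) (n j : ℕ) : splitMass x (n : ℕ∞) j =
    if j ≤ n then (catalan j * catalan (n - j) / catalan (n + 1) : ℝ) else 0 := rfl

theorem splitMass_nonneg {x : ℝ} (hx : 0 ≤ x) (m : ℕ∞) (j : ℕ) : 0 ≤ splitMass x m j := by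
  induction m using ENat.recTopCoe with
  | top => rw [splitMass_top]; positivity
  | coe n => rw [splitMass_coe]; split_ifs <;> positivity

/-- The probability that the left subtree has fewer than `j` nodes. -/
noncomputable def splitCdf (x : ℝ) (m : ℕ∞) (j : ℕ) : ℝ := ∑ i ∈ Finset.range j, splitMass x m i

theorem splitCdf_zero (x : ℝ) (m : ℕ∞) : splitCdf x m 0 = 0 := rfl

theorem splitCdf_succ (x : ℝ) (m : ℕ∞) (j : ℕ) :
    splitCdf x m (j + 1) = splitCdf x m j + splitMass x m j := Finset.sum_range_succ _ _

theorem splitCdf_mono {x : ℝ} (hx : 0 ≤ x) (m : ℕ∞) : Monotone (splitCdf x m) :=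
  monotone_nat_of_le_succ fun j => by
    rw [splitCdf_succ]; linarith [splitMass_nonneg hx m j]

/-- The masses are invariant under i ↦ n - i, so the upper tail from j is the lower tail up to k.
This is what allows the right subtree to be sampled with 1 - u. -/
theorem splitCdf_coe_add (x : ℝ) {n j k : ℕ} (h : j + k = n + 1) :
    splitCdf x n j + splitCdf x n k = 1 := by
  have hC : (catalan (n + 1) : ℝ) ≠ 0 := by exact_mod_cast (catalan_pos _).ne'
  have h1 : ∑ i ∈ Finset.range (j + k), splitMass x n i = 1 := by
    rw [h, Finset.sum_congr rfl (g := fun i => (catalan i * catalan (n - i) / catalan (n + 1) : ℝ))]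
    · rw [← Finset.sum_div, div_eq_one_iff_eq hC, catalan_succ',
        Finset.Nat.sum_antidiagonal_eq_sum_range_succ (fun a b => catalan a * catalan b)]
      push_cast
      rfl
    · intro i hi
      rw [splitMass_coe, if_pos (Nat.lt_succ_iff.1 (Finset.mem_range.1 hi))]
  rw [Finset.sum_range_add] at h1
  rw [splitCdf, splitCdf, ← h1, ← Finset.sum_range_reflect (fun i => splitMass x n (j + i))]
  congr 1
  refine Finset.sum_congr rfl fun i hi => ?_
  have hi := Finset.mem_range.1 hi
  rw [splitMass_coe, splitMass_coe, if_pos (by omega), if_pos (by omega)]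
  rw [show n - (j + (k - 1 - i)) = i by omega, show j + (k - 1 - i) = n - i by omega, mul_comm]

theorem splitCdf_coe_of_lt (x : ℝ) {n j : ℕ} (h : n < j) : splitCdf x n j = 1 := by
  have h0 : splitCdf x n (n + 1) = 1 := by
    simpa [splitCdf_zero] using splitCdf_coe_add x (n := n) (j := n + 1) (k := 0) rfl
  induction j, Nat.succ_le_of_lt h using Nat.le_induction with
  | base => exact h0
  | succ j hj ih =>
    have hj' : n < j := hj
    rw [splitCdf_succ, ih hj', splitMass_coe, if_neg (by omega), add_zero]

/-- For j ≤ n the comparison already holds mass by mass, by monotonicity of the Catalan ratios; for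
larger j the right side is 1. -/
theorem splitCdf_coe_succ_le (x : ℝ) (n j : ℕ) :
    splitCdf x (n + 1 : ℕ) j ≤ splitCdf x n j := by
  obtain h | h := lt_or_ge n j
  · rw [splitCdf_coe_of_lt x h]
    obtain h' | h' := lt_or_ge (n + 1) j
    · rw [splitCdf_coe_of_lt x h']
    · obtain rfl : j = n + 1 := by omega
      have := splitCdf_coe_add x (n := n + 1) (j := n + 1) (k := 1) rfl
      have h2 : 0 ≤ splitCdf x (n + 1 : ℕ) 1 := by
        rw [splitCdf_succ, splitCdf_zero, zero_add, splitMass_coe]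
        split_ifs <;> positivity
      linarith
  · refine Finset.sum_le_sum fun i hi => ?_
    have hi := Finset.mem_range.1 hi
    rw [splitMass_coe, splitMass_coe, if_pos (by omega), if_pos (by omega),
      div_le_div_iff₀ (by exact_mod_cast catalan_pos _) (by exact_mod_cast catalan_pos _)]
    have := catalan_succ_mul_catalan_le (m := n - i) (n := n + 1) (by omega)
    rw [show n + 1 - i = n - i + 1 by omega]
    have h2 : catalan i * catalan (n - i + 1) * catalan (n + 1) ≤
        catalan i * catalan (n - i) * catalan (n + 1 + 1) := by
      rw [mul_assoc, mul_assoc]; gcongr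
    exact_mod_cast h2

/-- Again mass by mass while j ≤ n: C_{n+1} ≤ 4^{i+1} C_{n-i} and x ≤ 1/4. Beyond n the finite
distribution function is 1, which is where `hone` enters. -/
theorem splitCdf_top_le_coe {x : ℝ} (hx : 0 ≤ x) (hx4 : x ≤ 1 / 4) (n j : ℕ)
    (hone : splitCdf x ⊤ j ≤ 1) : splitCdf x ⊤ j ≤ splitCdf x n j := by
  obtain h | h := lt_or_ge n j
  · rwa [splitCdf_coe_of_lt x h]
  · refine Finset.sum_le_sum fun i hi => ?_
    have hi := Finset.mem_range.1 hi
    rw [splitMass_coe, splitMass_top, if_pos (by omega),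
      le_div_iff₀ (by exact_mod_cast catalan_pos _), mul_assoc]
    gcongr
    have h1 : (catalan (n + 1) : ℝ) ≤ 4 ^ (i + 1) * catalan (n - i) := by
      have := catalan_add_le (n - i) (i + 1)
      rw [show n - i + (i + 1) = n + 1 by omega] at this
      exact_mod_cast this
    calc x ^ (i + 1) * catalan (n + 1) ≤ (1 / 4) ^ (i + 1) * (4 ^ (i + 1) * catalan (n - i)) := by
          gcongr
      _ = catalan (n - i) := by
          rw [← mul_assoc, ← mul_pow]; norm_num

/-- The finite sizes carry total mass below 1/2, so u and 1 - u can never both give a finite subtree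
of an infinite tree. -/
theorem splitCdf_top_le {p : ℝ} (hp : 1 / 2 < p) (hp1 : p ≤ 1) (j : ℕ) :
    splitCdf (p * (1 - p)) ⊤ j ≤ 1 - p := by
  have hp0 : 0 < p := by linarith
  have h := sum_range_catalan_mul_pow_le hp0 hp1 j
  calc splitCdf (p * (1 - p)) ⊤ j
      = p * (1 - p) * ∑ j ∈ Finset.range j, (catalan j : ℝ) * (p * (1 - p)) ^ j := by
        rw [splitCdf, Finset.mul_sum]
        exact Finset.sum_congr rfl fun i _ => by rw [splitMass_top]; ring
    _ ≤ p * (1 - p) * (1 / p) :=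
        mul_le_mul_of_nonneg_left h (mul_nonneg hp0.le (by linarith))
    _ = 1 - p := by field_simp

theorem hasSum_splitMass_top {p : ℝ} (hp : 1 / 2 < p) (hp1 : p ≤ 1) :
    HasSum (splitMass (p * (1 - p)) ⊤) (1 - p) := by
  have h := (hasSum_catalan_mul_pow hp hp1).mul_left (p * (1 - p))
  have hp0 : p ≠ 0 := by linarith
  rw [show p * (1 - p) * (1 / p) = 1 - p by field_simp] at h
  refine h.congr_fun fun j => ?_
  rw [splitMass_top]
  ring

theorem splitCdf_antitone {p : ℝ} (hp : 1 / 2 < p) (hp1 : p ≤ 1) {m m' : ℕ∞} (h : m ≤ m') (j : ℕ) :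
    splitCdf (p * (1 - p)) m' j ≤ splitCdf (p * (1 - p)) m j := by
  have hx : 0 ≤ p * (1 - p) := mul_nonneg (by linarith) (by linarith)
  have hx4 : p * (1 - p) ≤ 1 / 4 := by nlinarith [sq_nonneg (p - 1 / 2)]
  induction m' using ENat.recTopCoe with
  | top =>
    induction m using ENat.recTopCoe with
    | top => exact le_rfl
    | coe n =>
      exact splitCdf_top_le_coe hx hx4 n j (by linarith [splitCdf_top_le hp hp1 j])
  | coe n' =>
    lift m to ℕ using ne_top_of_le_ne_top (ENat.natCast_ne_top n') h
    exact antitone_nat_of_succ_le (f := fun n : ℕ => splitCdf (p * (1 - p)) n j)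
      (fun n => splitCdf_coe_succ_le _ n j) (by exact_mod_cast h)

/-- The quantile function of the law with masses `splitMass x m` on `ℕ`, the remaining mass
being at `⊤`. -/
noncomputable def splitQuantile (x : ℝ) (m : ℕ∞) (u : ℝ) : ℕ∞ :=
  ⨅ (j : ℕ) (_ : u ≤ splitCdf x m (j + 1)), (j : ℕ∞)

theorem splitQuantile_mono {p : ℝ} (hp : 1 / 2 < p) (hp1 : p ≤ 1) {m m' : ℕ∞} (h : m ≤ m')
    (u : ℝ) : splitQuantile (p * (1 - p)) m u ≤ splitQuantile (p * (1 - p)) m' u :=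
  le_iInf₂ fun j hj => iInf₂_le j (hj.trans (splitCdf_antitone hp hp1 h _))

theorem splitQuantile_eq_coe {x : ℝ} (hx : 0 ≤ x) {m : ℕ∞} {u : ℝ} {j : ℕ}
    (h : splitCdf x m j < u) (h' : u ≤ splitCdf x m (j + 1)) : splitQuantile x m u = j := by
  refine le_antisymm (iInf₂_le j h') (le_iInf₂ fun i hi => ?_)
  rw [Nat.cast_le]
  by_contra! hij
  exact absurd (hi.trans (splitCdf_mono hx m (Nat.succ_le_of_lt hij))) (not_le.2 h)

theorem splitQuantile_eq_top {x : ℝ} {m : ℕ∞} {u : ℝ} (h : ∀ j, splitCdf x m j < u) :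
    splitQuantile x m u = ⊤ :=
  iInf₂_eq_top.2 fun _ hj => absurd hj (not_le.2 (h _))

theorem measurable_splitQuantile (x : ℝ) (m : ℕ∞) : Measurable (splitQuantile x m) := by
  have hm : Monotone (splitQuantile x m) := fun u v huv =>
    le_iInf₂ fun j hj => iInf₂_le j (huv.trans hj)
  exact measurable_to_countable' fun a =>
    (Set.ordConnected_singleton.preimage_mono hm).measurableSet

/-- The size of the left (`b = false`) or right (`b = true`) subtree of a binary tree of size `r`,
as a function of a uniform random number `u`. -/
noncomputable def childRank (p : ℝ) (b : Bool) (r : ℕ∞) (u : ℝ) : ℕ∞ :=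
  if r = 0 then 0 else splitQuantile (p * (1 - p)) (r - 1) (if b then 1 - u else u)

theorem childRank_zero (p : ℝ) (b : Bool) (u : ℝ) : childRank p b 0 u = 0 := if_pos rfl

theorem childRank_coe_succ (p : ℝ) (b : Bool) (n : ℕ) (u : ℝ) :
    childRank p b (n + 1 : ℕ) u = splitQuantile (p * (1 - p)) n (if b then 1 - u else u) := by
  rw [childRank, if_neg (by simp)]
  rfl

theorem childRank_top (p : ℝ) (b : Bool) (u : ℝ) :
    childRank p b ⊤ u = splitQuantile (p * (1 - p)) ⊤ (if b then 1 - u else u) := by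
  rw [childRank, if_neg (by simp)]
  rfl

theorem childRank_mono {p : ℝ} (hp : 1 / 2 < p) (hp1 : p ≤ 1) (b : Bool) {r r' : ℕ∞} (h : r ≤ r')
    (u : ℝ) : childRank p b r u ≤ childRank p b r' u := by
  obtain rfl | h1 := eq_or_ne r 0
  · rw [childRank_zero]
    exact bot_le
  · rw [childRank, childRank, if_neg h1, if_neg (h.trans_lt' (pos_iff_ne_zero.2 h1)).ne']
    exact splitQuantile_mono hp hp1 (tsub_le_tsub_right h 1) _

theorem measurable_childRank (p : ℝ) (b : Bool) (r : ℕ∞) : Measurable (childRank p b r) := by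
  unfold childRank
  split_ifs
  · exact measurable_const
  · exact (measurable_splitQuantile _ _).comp (measurable_const.sub measurable_id)
  · exact measurable_splitQuantile _ _

/-- One of the two subtrees of an infinite tree is infinite. -/
theorem exists_childRank_top {p : ℝ} (hp : 1 / 2 < p) (hp1 : p ≤ 1) (u : ℝ) :
    ∃ b, childRank p b ⊤ u = ⊤ := by
  obtain h | h := lt_or_ge (1 - p) u
  · refine ⟨false, ?_⟩
    rw [childRank_top]
    exact splitQuantile_eq_top fun j => (splitCdf_top_le hp hp1 j).trans_lt h
  · refine ⟨true, ?_⟩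
    rw [childRank_top]
    exact splitQuantile_eq_top fun j => (splitCdf_top_le hp hp1 j).trans_lt (by
      simp only [if_true]; linarith)

/-! ### Joint law of the two subtree sizes -/

/-- The uniform distribution on the unit interval. -/
noncomputable def unif : Measure ℝ := volume.restrict (Set.Ioo 0 1)

instance : IsProbabilityMeasure unif := ⟨by simp [unif]⟩

theorem unif_Ioo {a b : ℝ} (ha : 0 ≤ a) (hb : b ≤ 1) :
    unif (Set.Ioo a b) = ENNReal.ofReal (b - a) := by
  rw [unif, Measure.restrict_apply measurableSet_Ioo, Set.Ioo_inter_Ioo, sup_eq_left.2 ha,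
    inf_eq_left.2 hb, Real.volume_Ioo]

/-- The cells need only have total mass 1 instead of covering the space, so that open intervals can
be used and their endpoints ignored. -/
theorem lintegral_eq_tsum_of_partition {α ι : Type*} [MeasurableSpace α] [Countable ι]
    {μ : Measure α} [IsProbabilityMeasure μ] {s : ι → Set α} (hs : ∀ i, MeasurableSet (s i))
    (hd : Pairwise (Function.onFun Disjoint s)) (h1 : ∑' i, μ (s i) = 1) {f : α → ENNReal}
    {c : ι → ENNReal} (hc : ∀ i, ∀ a ∈ s i, f a = c i) :
    ∫⁻ a, f a ∂μ = ∑' i, μ (s i) * c i := by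
  have hU : μ (⋃ i, s i) = 1 := by rw [measure_iUnion hd hs, h1]
  have hr : μ.restrict (⋃ i, s i) = μ :=
    Measure.restrict_eq_self_of_ae_mem ((mem_ae_iff_prob_eq_one (.iUnion hs)).2 hU)
  calc ∫⁻ a, f a ∂μ = ∫⁻ a in ⋃ i, s i, f a ∂μ := by rw [hr]
    _ = ∑' i, ∫⁻ a in s i, f a ∂μ := lintegral_iUnion hs hd f
    _ = ∑' i, μ (s i) * c i := by
      refine tsum_congr fun i => ?_
      rw [setLIntegral_congr_fun (hs i) (hc i), setLIntegral_const, mul_comm]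

open scoped ENNReal in
/-- The sizes of the two subtrees of a uniform binary tree with `n + 1` nodes. -/
theorem lintegral_childRank_succ {p : ℝ} (hp : 1 / 2 < p) (hp1 : p ≤ 1) (n : ℕ)
    (φ : ℕ∞ → ℕ∞ → ℝ≥0∞) :
    ∫⁻ u, φ (childRank p false (n + 1 : ℕ) u) (childRank p true (n + 1 : ℕ) u) ∂unif =
      ∑ ij ∈ Finset.HasAntidiagonal.antidiagonal n,
        ENNReal.ofReal (catalan ij.1 * catalan ij.2 / catalan (n + 1)) * φ ij.1 ij.2 := by
  have hx : 0 ≤ p * (1 - p) := mul_nonneg (by linarith) (by linarith)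
  set x := p * (1 - p) with hxdef
  set s : Fin (n + 1) → Set ℝ := fun j => Set.Ioo (splitCdf x n j) (splitCdf x n (j + 1)) with hsdef
  have hfalse : ∀ j, ∀ u ∈ s j, childRank p false (n + 1 : ℕ) u = (j : ℕ) := fun j u hu => by
    rw [childRank_coe_succ]
    exact splitQuantile_eq_coe hx hu.1 hu.2.le
  -- By symmetry u ↦ 1 - u maps the j-th quantile interval onto the (n - j)-th.
  have htrue : ∀ j, ∀ u ∈ s j, childRank p true (n + 1 : ℕ) u = (n - j : ℕ) := fun j u hu => by
    rw [childRank_coe_succ]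
    have h1 := splitCdf_coe_add x (n := n) (j := j + 1) (k := n - j) (by omega)
    have h2 := splitCdf_coe_add x (n := n) (j := j) (k := n - j + 1) (by omega)
    have := hu.1
    have := hu.2
    refine splitQuantile_eq_coe hx ?_ ?_ <;> simp only [if_true] <;> linarith
  have hμ : ∀ j : Fin (n + 1), unif (s j) = ENNReal.ofReal (splitMass x n j) := fun j => by
    rw [hsdef, unif_Ioo, splitCdf_succ]
    · simp
    · exact splitCdf_zero x n ▸ splitCdf_mono hx n (Nat.zero_le _)
    · rw [← splitCdf_coe_of_lt x (Nat.lt_succ_self n)]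
      exact splitCdf_mono hx n (by omega)
  refine (lintegral_eq_tsum_of_partition (s := s)
    (c := fun j : Fin (n + 1) => φ (j : ℕ) (n - j : ℕ)) (fun j => measurableSet_Ioo)
    ?_ ?_ ?_).trans ?_
  rotate_right
  · rw [tsum_fintype, Finset.Nat.sum_antidiagonal_eq_sum_range_succ
      (fun a b => ENNReal.ofReal (catalan a * catalan b / catalan (n + 1)) * φ a b),
      Finset.sum_range]
    refine Finset.sum_congr rfl fun j _ => ?_
    rw [hμ, splitMass_coe, if_pos (by omega)]
  · intro i j hij
    refine Set.disjoint_left.2 fun u hi hj => hij ?_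
    have := (hfalse i u hi).symm.trans (hfalse j u hj)
    exact Fin.ext (by exact_mod_cast this)
  · rw [tsum_fintype]
    simp_rw [hμ]
    rw [← Finset.sum_range (fun j => ENNReal.ofReal (splitMass x n j)),
      ← ENNReal.ofReal_sum_of_nonneg fun j _ => splitMass_nonneg hx n j]
    rw [show ∑ j ∈ Finset.range (n + 1), splitMass x n j = 1 from
      splitCdf_coe_of_lt x (Nat.lt_succ_self n), ENNReal.ofReal_one]
  · intro j u hu
    rw [hfalse j u hu, htrue j u hu]

open scoped ENNReal in
/-- The sizes of the two subtrees of an infinite percolation tree. -/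
theorem lintegral_childRank_top {p : ℝ} (hp : 1 / 2 < p) (hp1 : p ≤ 1) (φ : ℕ∞ → ℕ∞ → ℝ≥0∞) :
    ∫⁻ u, φ (childRank p false ⊤ u) (childRank p true ⊤ u) ∂unif =
      ∑' j : ℕ, ENNReal.ofReal (catalan j * (p * (1 - p)) ^ (j + 1)) * φ j ⊤ +
      ∑' j : ℕ, ENNReal.ofReal (catalan j * (p * (1 - p)) ^ (j + 1)) * φ ⊤ j +
      ENNReal.ofReal (2 * p - 1) * φ ⊤ ⊤ := by
  have hx : 0 ≤ p * (1 - p) := mul_nonneg (by linarith) (by linarith)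
  have hle := splitCdf_top_le hp hp1
  have hsum := hasSum_splitMass_top hp hp1
  have hnn := splitMass_nonneg hx ⊤
  have h0 : ∀ j, 0 ≤ splitCdf (p * (1 - p)) ⊤ j := fun j =>
    splitCdf_zero (p * (1 - p)) ⊤ ▸ splitCdf_mono hx ⊤ (Nat.zero_le _)
  set x := p * (1 - p) with hxdef
  -- Up to null sets: left subtree finite for u < 1 - p, right subtree finite for u > p, both
  -- infinite in between.
  set s : (ℕ ⊕ ℕ) ⊕ Unit → Set ℝ := fun i => match i with
    | .inl (.inl j) => Set.Ioo (splitCdf x ⊤ j) (splitCdf x ⊤ (j + 1))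
    | .inl (.inr j) => Set.Ioo (1 - splitCdf x ⊤ (j + 1)) (1 - splitCdf x ⊤ j)
    | .inr _ => Set.Ioo (1 - p) p with hsdef
  set c : (ℕ ⊕ ℕ) ⊕ Unit → ℕ∞ × ℕ∞ := fun i => match i with
    | .inl (.inl j) => (j, ⊤)
    | .inl (.inr j) => (⊤, j)
    | .inr _ => (⊤, ⊤) with hcdef
  have hc : ∀ i, ∀ u ∈ s i, (childRank p false ⊤ u, childRank p true ⊤ u) = c i := by
    rintro ((j | j) | _) u ⟨h1, h2⟩ <;> simp only [childRank_top, Bool.false_eq_true, if_true,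
      if_false, hcdef, Prod.mk.injEq]
    · exact ⟨splitQuantile_eq_coe hx h1 h2.le, splitQuantile_eq_top fun i => by
        linarith [hle i, hle (j + 1)]⟩
    · exact ⟨splitQuantile_eq_top fun i => by linarith [hle i, hle (j + 1)],
        splitQuantile_eq_coe hx (by linarith) (by linarith)⟩
    · exact ⟨splitQuantile_eq_top fun i => by linarith [hle i],
        splitQuantile_eq_top fun i => by linarith [hle i]⟩
  have hinj : Function.Injective c := by
    rintro ((i | i) | _) ((j | j) | _) h <;> simp_all
  have hμ1 : ∀ j, unif (s (.inl (.inl j))) = ENNReal.ofReal (splitMass x ⊤ j) := fun j => by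
    rw [hsdef]
    dsimp only
    rw [unif_Ioo (h0 j) (by linarith [hle (j + 1)]), splitCdf_succ, add_sub_cancel_left]
  have hμ2 : ∀ j, unif (s (.inl (.inr j))) = ENNReal.ofReal (splitMass x ⊤ j) := fun j => by
    rw [hsdef]
    dsimp only
    rw [unif_Ioo (by linarith [hle (j + 1)]) (by linarith [h0 j]), splitCdf_succ]
    congr 1
    ring
  have hμ3 : unif (s (.inr ())) = ENNReal.ofReal (2 * p - 1) := by
    rw [hsdef]
    dsimp only
    rw [unif_Ioo (by linarith) hp1]
    congr 1
    ring
  refine (lintegral_eq_tsum_of_partition (s := s) (c := fun i => φ (c i).1 (c i).2)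
    ?_ ?_ ?_ ?_).trans ?_
  rotate_right
  · rw [Summable.tsum_sum ENNReal.summable ENNReal.summable,
      Summable.tsum_sum ENNReal.summable ENNReal.summable]
    simp [hμ1, hμ2, hμ3, hcdef, splitMass_top]
  · rintro ((j | j) | _) <;> exact measurableSet_Ioo
  · intro i j hij
    refine Set.disjoint_left.2 fun u hi hj => hij (hinj ?_)
    rw [← hc i u hi, ← hc j u hj]
  · rw [Summable.tsum_sum ENNReal.summable ENNReal.summable,
      Summable.tsum_sum ENNReal.summable ENNReal.summable]
    simp only [hμ1, hμ2, hμ3, tsum_fintype, Finset.univ_unique, Finset.sum_singleton]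
    rw [← ENNReal.ofReal_tsum_of_nonneg hnn hsum.summable, hsum.tsum_eq,
      ← ENNReal.ofReal_add, ← ENNReal.ofReal_add, ← ENNReal.ofReal_one]
    · congr 1
      ring
    all_goals linarith
  · intro i u hu
    rw [← hc i u hu]

/-! ### Independent uniforms on the infinite binary tree -/

/-- A real number for every vertex of the infinite binary tree. -/
abbrev BinaryEnv : Type := List Bool → ℝ

/-- The law of independent uniform random numbers at the vertices of the infinite binary tree. -/
noncomputable def binaryEnvLaw : Measure BinaryEnv := Measure.infinitePi fun _ => unif

instance : IsProbabilityMeasure binaryEnvLaw := inferInstanceAs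
  (IsProbabilityMeasure (Measure.infinitePi fun _ : List Bool => unif))

/-- The restriction of the environment to the left or right subtree. -/
def subEnv (b : Bool) (ω : BinaryEnv) : BinaryEnv := fun w => ω (b :: w)

theorem measurable_subEnv (b : Bool) : Measurable (subEnv b) :=
  measurable_pi_lambda _ fun _ => measurable_pi_apply _

/-- The environment with the given root value and restrictions to the two subtrees. -/
def joinEnv (x : ℝ × BinaryEnv × BinaryEnv) : BinaryEnv
  | [] => x.1
  | false :: w => x.2.1 w
  | true :: w => x.2.2 w

theorem measurable_joinEnv : Measurable joinEnv := by
  refine measurable_pi_lambda _ fun w => ?_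
  match w with
  | [] => exact measurable_fst
  | false :: w => exact (measurable_pi_apply w).comp (measurable_fst.comp measurable_snd)
  | true :: w => exact (measurable_pi_apply w).comp (measurable_snd.comp measurable_snd)

theorem prod_list_bool {M : Type*} [CommMonoid M] (s : Finset (List Bool)) (f : List Bool → M) :
    ∏ w ∈ s, f w = (if [] ∈ s then f [] else 1) *
      ((∏ w ∈ s.preimage (List.cons false) (List.cons_injective.injOn), f (false :: w)) *
        ∏ w ∈ s.preimage (List.cons true) (List.cons_injective.injOn), f (true :: w)) := by
  rw [← Finset.prod_filter_mul_prod_filter_not s (· = [])]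
  classical
  rw [Finset.prod_preimage', Finset.prod_preimage']
  congr 1
  · split_ifs with h
    · rw [show s.filter (· = []) = {[]} by ext w; simp_all, Finset.prod_singleton]
    · rw [show s.filter (· = []) = ∅ from
        Finset.filter_eq_empty_iff.2 fun w hw hw' => h (hw' ▸ hw), Finset.prod_empty]
  · rw [← Finset.prod_filter_mul_prod_filter_not _ (· ∈ Set.range (List.cons false)),
      Finset.filter_filter, Finset.filter_filter]
    congr 1 <;> refine Finset.prod_congr (Finset.filter_congr fun w _ => ?_) fun _ _ => rfl
    · rcases w with _ | ⟨_ | _, w⟩ <;> simp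
    · rcases w with _ | ⟨_ | _, w⟩ <;> simp

theorem map_joinEnv : (unif.prod (binaryEnvLaw.prod binaryEnvLaw)).map joinEnv = binaryEnvLaw := by
  refine Measure.eq_infinitePi _ fun s t ht => ?_
  rw [Measure.map_apply measurable_joinEnv (.pi s.countable_toSet fun i _ => ht i)]
  have : joinEnv ⁻¹' (Set.pi s t) = (if [] ∈ s then t [] else Set.univ) ×ˢ
      (Set.pi (s.preimage (List.cons false) (List.cons_injective.injOn)) (fun w => t (false :: w)) ×ˢ
        Set.pi (s.preimage (List.cons true) (List.cons_injective.injOn))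
          (fun w => t (true :: w))) := by
    ext ⟨u, ω, ω'⟩
    simp only [Set.mem_preimage, Set.mem_pi, Set.mem_prod, Finset.coe_preimage, Finset.mem_coe]
    constructor
    · intro h
      refine ⟨?_, fun w hw => h _ hw, fun w hw => h _ hw⟩
      split_ifs with h0
      · exact h _ h0
      · trivial
    · rintro ⟨h0, h1, h2⟩ (_ | ⟨_ | _, w⟩) hw
      · rwa [if_pos hw] at h0
      · exact h1 w hw
      · exact h2 w hw
  rw [this, Measure.prod_prod, Measure.prod_prod, prod_list_bool, binaryEnvLaw,
    Measure.infinitePi_pi _ fun i _ => ht _, Measure.infinitePi_pi _ fun i _ => ht _]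
  congr 1
  split_ifs <;> simp

/-- The root value and the restrictions to the two subtrees are independent. -/
theorem map_root_subEnv :
    binaryEnvLaw.map (fun ω => (ω [], subEnv false ω, subEnv true ω)) =
      unif.prod (binaryEnvLaw.prod binaryEnvLaw) := by
  conv_lhs => rw [← map_joinEnv]
  rw [Measure.map_map _ measurable_joinEnv]
  · exact Measure.map_id
  · exact (measurable_pi_apply _).prodMk ((measurable_subEnv _).prodMk (measurable_subEnv _))

/-! ### The recursive random binary tree -/

/-- The number of nodes of the subtree at `w`, of a tree with `r` nodes. -/
noncomputable def rank (p : ℝ) : List Bool → ℕ∞ → BinaryEnv → ℕ∞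
  | [], r, _ => r
  | b :: w, r, ω => rank p w (childRank p b r (ω [])) (subEnv b ω)

/-- A random binary tree with `r` nodes. -/
def rankTree (p : ℝ) (r : ℕ∞) (ω : BinaryEnv) : Set (List Bool) := {w | rank p w r ω ≠ 0}

theorem rank_zero (p : ℝ) (w : List Bool) (ω : BinaryEnv) : rank p w 0 ω = 0 := by
  induction w generalizing ω with
  | nil => rfl
  | cons b w ih => rw [rank, childRank_zero, ih]

theorem rankTree_zero (p : ℝ) (ω : BinaryEnv) : rankTree p 0 ω = ∅ :=
  Set.eq_empty_of_forall_notMem fun w hw => hw (rank_zero p w ω)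

theorem rank_mono {p : ℝ} (hp : 1 / 2 < p) (hp1 : p ≤ 1) (w : List Bool) {r r' : ℕ∞} (h : r ≤ r')
    (ω : BinaryEnv) : rank p w r ω ≤ rank p w r' ω := by
  induction w generalizing r r' ω with
  | nil => exact h
  | cons b w ih => exact ih (childRank_mono hp hp1 b h _) _

theorem rankTree_mono {p : ℝ} (hp : 1 / 2 < p) (hp1 : p ≤ 1) {r r' : ℕ∞} (h : r ≤ r')
    (ω : BinaryEnv) : rankTree p r ω ⊆ rankTree p r' ω := fun w hw =>
  ((pos_iff_ne_zero.2 hw).trans_le (rank_mono hp hp1 w h ω)).ne'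

theorem rank_append (p : ℝ) (w v : List Bool) (r : ℕ∞) (ω : BinaryEnv) :
    rank p (w ++ v) r ω = rank p v (rank p w r ω) (fun u => ω (w ++ u)) := by
  induction w generalizing r ω with
  | nil => rfl
  | cons b w ih => exact ih _ _

theorem measurable_rank (p : ℝ) (w : List Bool) (r : ℕ∞) : Measurable (rank p w r) := by
  induction w generalizing r with
  | nil => exact measurable_const
  | cons b w ih =>
    have h : Measurable fun x : ℕ∞ × BinaryEnv => rank p w x.1 x.2 :=
      measurable_from_prod_countable_right ih
    exact h.comp (((measurable_childRank p b r).comp (measurable_pi_apply _)).prodMk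
      (measurable_subEnv b))

theorem measurable_rankTree (p : ℝ) (r : ℕ∞) : Measurable (rankTree p r) :=
  measurable_set_iff.2 fun w => (Measurable.of_discrete (f := fun r : ℕ∞ => r ≠ 0)).comp
    (measurable_rank p w r)

/-- The left or right subtree. -/
def subtree (b : Bool) (S : Set (List Bool)) : Set (List Bool) := {w | b :: w ∈ S}

theorem nil_mem_rankTree {p : ℝ} {r : ℕ∞} (hr : r ≠ 0) (ω : BinaryEnv) : [] ∈ rankTree p r ω := hr

/-- The branching property: the root variable fixes the two sizes, and independent environments then
generate the two subtrees. -/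
theorem binaryEnvLaw_subtree_mem (p : ℝ) (r : ℕ∞) {A B : Set (Set (List Bool))}
    (hA : MeasurableSet A) (hB : MeasurableSet B) :
    binaryEnvLaw {ω | subtree false (rankTree p r ω) ∈ A ∧ subtree true (rankTree p r ω) ∈ B} =
      ∫⁻ u, binaryEnvLaw {ω | rankTree p (childRank p false r u) ω ∈ A} *
        binaryEnvLaw {ω | rankTree p (childRank p true r u) ω ∈ B} ∂unif := by
  have hm (b : Bool) : Measurable fun x : ℝ × BinaryEnv =>
      rankTree p (childRank p b r x.1) x.2 := by
    have h : Measurable fun x : ℕ∞ × BinaryEnv => rankTree p x.1 x.2 :=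
      measurable_from_prod_countable_right fun r => measurable_rankTree p r
    exact h.comp (((measurable_childRank p b r).comp measurable_fst).prodMk measurable_snd)
  have hE : MeasurableSet {x : ℝ × BinaryEnv × BinaryEnv |
      rankTree p (childRank p false r x.1) x.2.1 ∈ A ∧
        rankTree p (childRank p true r x.1) x.2.2 ∈ B} :=
    (((hm false).comp (measurable_fst.prodMk (measurable_fst.comp measurable_snd))) hA).inter
      (((hm true).comp (measurable_fst.prodMk (measurable_snd.comp measurable_snd))) hB)
  have h1 := Measure.map_apply (μ := binaryEnvLaw)
    (f := fun ω => (ω [], subEnv false ω, subEnv true ω))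
    ((measurable_pi_apply _).prodMk ((measurable_subEnv _).prodMk (measurable_subEnv _))) hE
  rw [map_root_subEnv, Measure.prod_apply hE] at h1
  refine h1.symm.trans (lintegral_congr fun u => ?_)
  rw [← Measure.prod_prod]
  rfl

/-! ### Probabilities of finite binary trees -/

/-- The set of nodes of a binary tree, as words that lead to them from the root. -/
def nodes : BinaryTree Unit → Set (List Bool)
  | .nil => ∅
  | .node _ l r => {w | match w with
    | [] => True
    | false :: w => w ∈ nodes l
    | true :: w => w ∈ nodes r}

theorem nodes_node_subset_iff (l r : BinaryTree Unit) (S : Set (List Bool)) :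
    nodes (.node () l r) ⊆ S ↔ [] ∈ S ∧ nodes l ⊆ subtree false S ∧ nodes r ⊆ subtree true S := by
  constructor
  · intro h
    exact ⟨h (a := []) trivial, fun w hw => h (a := false :: w) hw,
      fun w hw => h (a := true :: w) hw⟩
  · rintro ⟨h0, h1, h2⟩ (_ | ⟨_ | _, w⟩) hw
    · exact h0
    · exact h1 hw
    · exact h2 hw

theorem eq_nodes_node_iff (l r : BinaryTree Unit) (S : Set (List Bool)) :
    S = nodes (.node () l r) ↔ [] ∈ S ∧ subtree false S = nodes l ∧ subtree true S = nodes r := by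
  constructor
  · rintro rfl
    exact ⟨trivial, rfl, rfl⟩
  · rintro ⟨h0, h1, h2⟩
    ext (_ | ⟨_ | _, w⟩)
    · exact ⟨fun _ => trivial, fun _ => h0⟩
    · exact Set.ext_iff.1 h1 w
    · exact Set.ext_iff.1 h2 w

theorem measurableSet_superset {α : Type*} [Countable α] (F : Set α) :
    MeasurableSet {S : Set α | F ⊆ S} := by
  have : {S : Set α | F ⊆ S} = ⋂ a ∈ F, {S | a ∈ S} := by
    ext S
    simp [Set.subset_def]
  rw [this]
  exact .biInter F.to_countable fun a _ => measurableSet_mem a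

open scoped ENNReal

theorem binaryEnvLaw_nodes_node_subset (p : ℝ) {r : ℕ∞} (hr : r ≠ 0) (s t : BinaryTree Unit) :
    binaryEnvLaw {ω | nodes (.node () s t) ⊆ rankTree p r ω} =
      ∫⁻ u, binaryEnvLaw {ω | nodes s ⊆ rankTree p (childRank p false r u) ω} *
        binaryEnvLaw {ω | nodes t ⊆ rankTree p (childRank p true r u) ω} ∂unif := by
  refine Eq.trans ?_ (binaryEnvLaw_subtree_mem p r (measurableSet_superset (nodes s))
    (measurableSet_superset (nodes t)))
  congr 1
  ext ω
  simp [nodes_node_subset_iff, nil_mem_rankTree hr]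

theorem binaryEnvLaw_eq_nodes_node (p : ℝ) {r : ℕ∞} (hr : r ≠ 0) (s t : BinaryTree Unit) :
    binaryEnvLaw {ω | rankTree p r ω = nodes (.node () s t)} =
      ∫⁻ u, binaryEnvLaw {ω | rankTree p (childRank p false r u) ω = nodes s} *
        binaryEnvLaw {ω | rankTree p (childRank p true r u) ω = nodes t} ∂unif := by
  have := binaryEnvLaw_subtree_mem p r (measurableSet_singleton (nodes s))
    (measurableSet_singleton (nodes t))
  simp only [Set.mem_singleton_iff] at this
  rw [← this]
  congr 1
  ext ω
  simp [eq_nodes_node_iff, nil_mem_rankTree hr]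

/-- Only the split into the actual subtree sizes of t is kept, and its Catalan factors cancel. A
lower bound is enough, because these bounds already add up to 1 over all trees of that size. -/
theorem inv_catalan_le_binaryEnvLaw {p : ℝ} (hp : 1 / 2 < p) (hp1 : p ≤ 1) (t : BinaryTree Unit) :
    (catalan t.numNodes : ℝ≥0∞)⁻¹ ≤ binaryEnvLaw {ω | rankTree p t.numNodes ω = nodes t} := by
  induction t with
  | nil => simp [BinaryTree.numNodes, nodes, rankTree_zero]
  | node _ l r ihl ihr =>
    rw [binaryEnvLaw_eq_nodes_node p (by simp [BinaryTree.numNodes]), BinaryTree.numNodes,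
      lintegral_childRank_succ hp hp1 _ (fun a b =>
        binaryEnvLaw {ω | rankTree p a ω = nodes l} * binaryEnvLaw {ω | rankTree p b ω = nodes r})]
    refine le_trans ?_ (Finset.single_le_sum (fun _ _ => bot_le)
      (Finset.HasAntidiagonal.mem_antidiagonal (a := (l.numNodes, r.numNodes)).2 rfl))
    refine le_trans ?_ (mul_le_mul_right (mul_le_mul' ihl ihr) _)
    have h1 := catalan_pos l.numNodes
    have h2 := catalan_pos r.numNodes
    have h3 := catalan_pos (l.numNodes + r.numNodes + 1)
    have key (n : ℕ) (hn : 0 < n) : (n : ℝ≥0∞)⁻¹ = ENNReal.ofReal ((n : ℝ)⁻¹) := by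
      rw [ENNReal.ofReal_inv_of_pos (by exact_mod_cast hn), ENNReal.ofReal_natCast]
    rw [key _ h1, key _ h2, key _ h3, ← ENNReal.ofReal_mul (by positivity),
      ← ENNReal.ofReal_mul (by positivity)]
    refine le_of_eq (congrArg _ ?_)
    have h1' : (catalan l.numNodes : ℝ) ≠ 0 := by positivity
    have h2' : (catalan r.numNodes : ℝ) ≠ 0 := by positivity
    field_simp

theorem ennreal_tsum_mul_tsum (f g : ℕ → ℝ≥0∞) :
    (∑' n, f n) * ∑' n, g n =
      ∑' n, ∑ ij ∈ Finset.HasAntidiagonal.antidiagonal n, f ij.1 * g ij.2 := by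
  rw [← ENNReal.tsum_mul_right]
  simp_rw [← ENNReal.tsum_mul_left]
  rw [← ENNReal.tsum_prod, ← Finset.HasAntidiagonal.sigmaAntidiagonalEquivProd.tsum_eq, ENNReal.tsum_sigma']
  refine tsum_congr fun n => ?_
  rw [tsum_fintype]
  exact Finset.sum_coe_sort _ fun ij : ℕ × ℕ => f ij.1 * g ij.2

/-- The probability that a binary percolation tree has `n` nodes. -/
noncomputable def sizeMass (p : ℝ) (n : ℕ) : ℝ := catalan n * p ^ n * (1 - p) ^ (n + 1)

theorem sizeMass_nonneg {p : ℝ} (hp : 1 / 2 < p) (hp1 : p ≤ 1) (n : ℕ) : 0 ≤ sizeMass p n := by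
  have : 0 ≤ 1 - p := by linarith
  have : 0 ≤ p := by linarith
  unfold sizeMass
  positivity

theorem hasSum_sizeMass {p : ℝ} (hp : 1 / 2 < p) (hp1 : p ≤ 1) :
    HasSum (sizeMass p) ((1 - p) / p) := by
  have h := (hasSum_catalan_mul_pow hp hp1).mul_left (1 - p)
  rw [mul_one_div] at h
  refine h.congr_fun fun j => ?_
  rw [sizeMass, mul_pow]
  ring

/-- The mixture of the trees with `r` nodes, `r ≤ ⊤`, is binary percolation: it contains a given
tree `t` with probability `p ^ t.numNodes`. -/
theorem tsum_sizeMass_mul_binaryEnvLaw {p : ℝ} (hp : 1 / 2 < p) (hp1 : p ≤ 1)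
    (t : BinaryTree Unit) :
    ∑' n : ℕ, ENNReal.ofReal (sizeMass p n) * binaryEnvLaw {ω | nodes t ⊆ rankTree p n ω} +
      ENNReal.ofReal ((2 * p - 1) / p) * binaryEnvLaw {ω | nodes t ⊆ rankTree p ⊤ ω} =
      ENNReal.ofReal (p ^ t.numNodes) := by
  have hp0 : 0 < p := by linarith
  have hnn := sizeMass_nonneg hp hp1
  have hsum := hasSum_sizeMass hp hp1
  induction t with
  | nil =>
    simp only [nodes, Set.empty_subset, Set.ofPred_true, measure_univ, mul_one,
      BinaryTree.numNodes, pow_zero]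
    rw [← ENNReal.ofReal_tsum_of_nonneg hnn hsum.summable, hsum.tsum_eq, ← ENNReal.ofReal_add]
    · congr 1
      field_simp
      ring
    · exact div_nonneg (by linarith) hp0.le
    · exact div_nonneg (by linarith) hp0.le
  | node _ l r ihl ihr =>
    -- The target is p(A + b f ⊤)(B + b g ⊤), with A and B the sums of `a j * f j` and `a j * g j`.
    -- Finite r contributes p A B; r = ⊤ contributes the three products with at least one infinite
    -- subtree.
    set f : ℕ∞ → ℝ≥0∞ := fun k => binaryEnvLaw {ω | nodes l ⊆ rankTree p k ω} with hf
    set g : ℕ∞ → ℝ≥0∞ := fun k => binaryEnvLaw {ω | nodes r ⊆ rankTree p k ω} with hg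
    set a : ℕ → ℝ≥0∞ := fun n => ENNReal.ofReal (sizeMass p n) with ha
    set b : ℝ≥0∞ := ENNReal.ofReal ((2 * p - 1) / p) with hb
    have h0 : binaryEnvLaw {ω | nodes (.node () l r) ⊆ rankTree p (0 : ℕ) ω} = 0 := by
      have : {ω | nodes (.node () l r) ⊆ rankTree p (0 : ℕ) ω} = ∅ := by
        refine Set.eq_empty_of_forall_notMem fun ω hω => ?_
        have : [] ∈ rankTree p (0 : ℕ) ω := hω (a := []) trivial
        rw [Nat.cast_zero, rankTree_zero] at this
        exact this
      rw [this, measure_empty]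
    have hsucc (n : ℕ) : a (n + 1) *
        binaryEnvLaw {ω | nodes (.node () l r) ⊆ rankTree p (n + 1 : ℕ) ω} =
        ENNReal.ofReal p * ∑ ij ∈ Finset.HasAntidiagonal.antidiagonal n,
          (a ij.1 * f ij.1) * (a ij.2 * g ij.2) := by
      rw [binaryEnvLaw_nodes_node_subset p (by simp),
        lintegral_childRank_succ hp hp1 n (fun i j => f i * g j), Finset.mul_sum, Finset.mul_sum]
      refine Finset.sum_congr rfl fun ij hij => ?_
      have key : a (n + 1) * ENNReal.ofReal (catalan ij.1 * catalan ij.2 / catalan (n + 1)) =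
          ENNReal.ofReal p * (a ij.1 * a ij.2) := by
        rw [ha]
        dsimp only
        rw [← ENNReal.ofReal_mul (hnn _), ← ENNReal.ofReal_mul (hnn _),
          ← ENNReal.ofReal_mul hp0.le]
        congr 1
        rw [← Finset.HasAntidiagonal.mem_antidiagonal.1 hij]
        have h3 : (catalan (ij.1 + ij.2 + 1) : ℝ) ≠ 0 := by
          exact_mod_cast (catalan_pos _).ne'
        simp only [sizeMass]
        field_simp
        ring
      rw [← mul_assoc, key]
      ring
    have htop : b * binaryEnvLaw {ω | nodes (.node () l r) ⊆ rankTree p ⊤ ω} =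
        ENNReal.ofReal p * ((∑' j : ℕ, a j * f j) * (b * g ⊤) + (b * f ⊤) * (∑' j : ℕ, a j * g j) +
          (b * f ⊤) * (b * g ⊤)) := by
      rw [binaryEnvLaw_nodes_node_subset p (by simp),
        lintegral_childRank_top hp hp1 (fun i j => f i * g j)]
      have hx (j : ℕ) : ENNReal.ofReal (catalan j * (p * (1 - p)) ^ (j + 1)) =
          ENNReal.ofReal p * a j := by
        rw [ha]
        dsimp only
        rw [← ENNReal.ofReal_mul hp0.le, sizeMass, mul_pow]
        congr 1
        ring
      have hy : ENNReal.ofReal (2 * p - 1) = ENNReal.ofReal p * b := by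
        rw [hb, ← ENNReal.ofReal_mul hp0.le]
        congr 1
        field_simp
      simp_rw [hx, hy]
      have h1 : ∑' j : ℕ, ENNReal.ofReal p * a j * (f j * g ⊤) =
          ENNReal.ofReal p * ((∑' j : ℕ, a j * f j) * g ⊤) := by
        rw [← ENNReal.tsum_mul_right, ← ENNReal.tsum_mul_left]
        exact tsum_congr fun j => by ring
      have h2 : ∑' j : ℕ, ENNReal.ofReal p * a j * (f ⊤ * g j) =
          ENNReal.ofReal p * (f ⊤ * (∑' j : ℕ, a j * g j)) := by
        rw [← ENNReal.tsum_mul_left, ← ENNReal.tsum_mul_left]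
        exact tsum_congr fun j => by ring
      rw [h1, h2]
      ring
    have hfin : ∑' n : ℕ, ENNReal.ofReal (sizeMass p n) *
        binaryEnvLaw {ω | nodes (.node () l r) ⊆ rankTree p n ω} =
        ENNReal.ofReal p * ((∑' j : ℕ, a j * f j) * ∑' j : ℕ, a j * g j) := by
      rw [tsum_eq_zero_add' ENNReal.summable, h0, mul_zero, zero_add,
        ennreal_tsum_mul_tsum, ← ENNReal.tsum_mul_left]
      exact tsum_congr hsucc
    rw [hfin, htop, BinaryTree.numNodes, pow_succ, pow_add,
      ENNReal.ofReal_mul (by positivity), ENNReal.ofReal_mul (by positivity), ← ihl, ← ihr]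
    ring

/-! ### First-child/next-sibling correspondence -/

/-- Increase the first letter of a word by one. -/
def bumpHead : Vertex → Vertex
  | [] => []
  | a :: v => (a + 1) :: v

/-- The vertex of the Ulam–Harris tree that corresponds to a node of the infinite binary tree: the
root is sent to the first child of `[]`, and the left and right child of a node are sent to
the first child and the next sibling of the corresponding vertex. -/
def toVertex : List Bool → Vertex
  | [] => [0]
  | false :: w => 0 :: toVertex w
  | true :: w => bumpHead (toVertex w)

theorem toVertex_ne_nil (w : List Bool) : toVertex w ≠ [] := by
  match w with
  | [] => simp [toVertex]
  | false :: w => simp [toVertex]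
  | true :: w =>
    have := toVertex_ne_nil w
    rw [toVertex]
    cases h : toVertex w with
    | nil => exact absurd h this
    | cons a v => simp [bumpHead]

theorem toVertex_injective : Function.Injective toVertex := by
  intro w
  induction w with
  | nil =>
    rintro (_ | ⟨_ | _, w⟩) h
    · rfl
    · simp only [toVertex, List.cons.injEq, true_and] at h
      exact absurd h.symm (toVertex_ne_nil w)
    · simp only [toVertex] at h
      cases h' : toVertex w <;> simp [h', bumpHead] at h
  | cons b w ih =>
    rintro (_ | ⟨c, w'⟩) h
    · cases b
      · simp only [toVertex, List.cons.injEq, true_and] at h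
        exact absurd h (toVertex_ne_nil w)
      · simp only [toVertex] at h
        cases h' : toVertex w <;> simp [h', bumpHead] at h
    · cases b <;> cases c <;> simp only [toVertex] at h
      · rw [ih (List.cons_injective h)]
      · cases h' : toVertex w' <;> simp [h', bumpHead] at h
      · cases h' : toVertex w <;> simp [h', bumpHead] at h
      · refine congrArg _ (ih ?_)
        cases h1 : toVertex w with
        | nil => exact absurd h1 (toVertex_ne_nil w)
        | cons a v =>
          cases h2 : toVertex w' with
          | nil => exact absurd h2 (toVertex_ne_nil w')
          | cons a' v' =>
            rw [h1, h2] at h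
            simpa [bumpHead] using h

theorem exists_toVertex_eq (a : ℕ) (v : Vertex) : ∃ w, toVertex w = a :: v := by
  induction v generalizing a with
  | nil =>
    induction a with
    | zero => exact ⟨[], rfl⟩
    | succ a ih =>
      obtain ⟨w, hw⟩ := ih
      exact ⟨true :: w, by rw [toVertex, hw, bumpHead]⟩
  | cons b v ihv =>
    induction a with
    | zero =>
      obtain ⟨w, hw⟩ := ihv b
      exact ⟨false :: w, by rw [toVertex, hw]⟩
    | succ a ih =>
      obtain ⟨w, hw⟩ := ih
      exact ⟨true :: w, by rw [toVertex, hw, bumpHead]⟩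

theorem toVertex_append_false (w : List Bool) : toVertex (w ++ [false]) = toVertex w ++ [0] := by
  induction w with
  | nil => rfl
  | cons b w ih =>
    cases b
    · simp [toVertex, ih]
    · simp only [List.cons_append, toVertex, ih]
      cases h : toVertex w with
      | nil => exact absurd h (toVertex_ne_nil w)
      | cons a v => rfl

theorem exists_toVertex_append_true (w : List Bool) :
    ∃ v i, toVertex w = v ++ [i] ∧ toVertex (w ++ [true]) = v ++ [i + 1] := by
  induction w with
  | nil => exact ⟨[], 0, rfl, rfl⟩
  | cons b w ih =>
    obtain ⟨v, i, h1, h2⟩ := ih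
    cases b
    · exact ⟨0 :: v, i, by simp [toVertex, h1], by simp [toVertex, h2]⟩
    · cases v with
      | nil => exact ⟨[], i + 1, by simp [toVertex, h1, bumpHead], by simp [toVertex, h2, bumpHead]⟩
      | cons a v =>
        exact ⟨(a + 1) :: v, i, by simp [toVertex, h1, bumpHead], by simp [toVertex, h2, bumpHead]⟩

/-- Sets of nodes of the infinite binary tree that are closed under taking the parent. -/
def IsParentClosed (S : Set (List Bool)) : Prop := ∀ w b, w ++ [b] ∈ S → w ∈ S

theorem IsParentClosed.append {S : Set (List Bool)} (hS : IsParentClosed S) {w u : List Bool}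
    (h : w ++ u ∈ S) : w ∈ S := by
  induction u using List.reverseRecOn with
  | nil => simpa using h
  | append_singleton u b ih => exact ih (hS _ b (by simpa using h))

theorem IsParentClosed.nil_mem {S : Set (List Bool)} (hS : IsParentClosed S) (h : S.Nonempty) :
    [] ∈ S := by
  obtain ⟨w, hw⟩ := h
  exact hS.append (w := []) (u := w) hw

theorem IsParentClosed.subtree {S : Set (List Bool)} (hS : IsParentClosed S) (b : Bool) :
    IsParentClosed (subtree b S) := fun w c h => hS (b :: w) c h

theorem isParentClosed_nodes (t : BinaryTree Unit) : IsParentClosed (nodes t) := by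
  induction t with
  | nil => exact fun _ _ h => h
  | node _ l r ihl ihr =>
    rintro (_ | ⟨_ | _, w⟩) b h
    · trivial
    · exact ihl w b h
    · exact ihr w b h

theorem encard_eq_of_nil_mem {S : Set (List Bool)} (h : [] ∈ S) :
    S.encard = (subtree false S).encard + (subtree true S).encard + 1 := by
  have hS : S = insert [] (List.cons false '' subtree false S ∪ List.cons true '' subtree true S) := by
    ext (_ | ⟨_ | _, w⟩) <;> simp [subtree, h]
  have hd : Disjoint (List.cons false '' subtree false S) (List.cons true '' subtree true S) := by
    rw [Set.disjoint_left]
    rintro _ ⟨w, _, rfl⟩ ⟨w', _, h'⟩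
    simp at h'
  conv_lhs => rw [hS]
  rw [Set.encard_insert_of_notMem (by simp), Set.encard_union_eq hd,
    List.cons_injective.encard_image, List.cons_injective.encard_image]

theorem encard_nodes (t : BinaryTree Unit) : (nodes t).encard = t.numNodes := by
  induction t with
  | nil => simp [nodes, BinaryTree.numNodes]
  | node _ l r ihl ihr =>
    rw [encard_eq_of_nil_mem (by trivial), BinaryTree.numNodes]
    push_cast
    rw [← ihl, ← ihr]
    rfl

theorem nodes_injective : Function.Injective nodes := by
  intro s
  induction s with
  | nil =>
    rintro (_ | ⟨_, l, r⟩) h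
    · rfl
    · exact absurd (show [] ∈ nodes .nil from h ▸ trivial) (Set.notMem_empty _)
  | node _ l r ihl ihr =>
    rintro (_ | ⟨_, l', r'⟩) h
    · exact absurd (show [] ∈ nodes .nil from h ▸ trivial) (Set.notMem_empty _)
    · obtain ⟨_, h1, h2⟩ := (eq_nodes_node_iff _ _ _).1 h
      rw [ihl h1, ihr h2]

theorem exists_nodes_eq {S : Set (List Bool)} (hS : IsParentClosed S) (hfin : S.Finite) :
    ∃ t, nodes t = S := by
  obtain ⟨n, hn⟩ : ∃ n : ℕ, S.encard = n := ⟨_, hfin.encard_eq_coe⟩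
  induction n using Nat.strong_induction_on generalizing S with
  | _ n ih =>
    obtain rfl | hne := S.eq_empty_or_nonempty
    · exact ⟨.nil, rfl⟩
    · have h0 := hS.nil_mem hne
      have hf (b : Bool) : (subtree b S).Finite :=
        hfin.preimage (List.cons_injective.injOn)
      have hcard := encard_eq_of_nil_mem h0
      rw [hn, (hf false).encard_eq_coe, (hf true).encard_eq_coe] at hcard
      norm_cast at hcard
      obtain ⟨l, hl⟩ := ih _ (by omega) (hS.subtree false) (hf false) (hf false).encard_eq_coe
      obtain ⟨r, hr⟩ := ih _ (by omega) (hS.subtree true) (hf true) (hf true).encard_eq_coe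
      exact ⟨.node () l r, ((eq_nodes_node_iff l r S).2 ⟨h0, hl.symm, hr.symm⟩).symm⟩

/-- The rooted ordered tree that corresponds to a binary tree. -/
def planeTree (S : Set (List Bool)) : Set Vertex := insert [] (toVertex '' S)

theorem toVertex_mem_planeTree {S : Set (List Bool)} {w : List Bool} :
    toVertex w ∈ planeTree S ↔ w ∈ S := by
  rw [planeTree, Set.mem_insert_iff, toVertex_injective.mem_set_image]
  exact or_iff_right (toVertex_ne_nil w)

theorem planeTree_subset_iff {S S' : Set (List Bool)} :
    planeTree S ⊆ planeTree S' ↔ S ⊆ S' :=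
  ⟨fun h _ hw => toVertex_mem_planeTree.1 (h (toVertex_mem_planeTree.2 hw)),
    fun h => Set.insert_subset_insert (Set.image_mono h)⟩

theorem planeTree_injective : Function.Injective planeTree := fun _ _ h =>
  (planeTree_subset_iff.1 h.le).antisymm (planeTree_subset_iff.1 h.ge)

theorem encard_planeTree (S : Set (List Bool)) : (planeTree S).encard = S.encard + 1 := by
  rw [planeTree, Set.encard_insert_of_notMem, toVertex_injective.encard_image]
  rintro ⟨w, _, hw⟩
  exact toVertex_ne_nil w hw

theorem measurable_planeTree : Measurable planeTree := by
  refine measurable_set_iff.2 fun v => ?_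
  cases v with
  | nil => simp [planeTree]
  | cons a v =>
    obtain ⟨w, hw⟩ := exists_toVertex_eq a v
    simp_rw [← hw, toVertex_mem_planeTree]
    exact measurable_set_mem w

/-- The binary parent of a node is either its plane parent or its preceding sibling. The plane
parent is therefore reached by walking up through the older siblings, hence the induction. -/
theorem isPlaneTree_planeTree {S : Set (List Bool)} (hS : IsParentClosed S) :
    IsPlaneTree (planeTree S) where
  root_mem := Set.mem_insert _ _
  parent_mem v i h := by
    obtain h | ⟨w, hw, hwv⟩ := h
    · simp at h
    · induction w using List.reverseRecOn generalizing v i with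
      | nil =>
        obtain ⟨rfl, _⟩ := List.append_inj' (show [] ++ [0] = v ++ [i] from hwv) rfl
        exact Set.mem_insert _ _
      | append_singleton w b ih =>
        cases b
        · rw [toVertex_append_false] at hwv
          obtain ⟨rfl, _⟩ := List.append_inj' hwv rfl
          exact toVertex_mem_planeTree.2 (hS _ _ hw)
        · obtain ⟨v', j, h1, h2⟩ := exists_toVertex_append_true w
          obtain ⟨rfl, _⟩ := List.append_inj' (h2.symm.trans hwv) rfl
          exact ih v' j (hS _ _ hw) h1
  sibling_mem v i h := by
    obtain h | ⟨w, hw, hwv⟩ := h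
    · simp at h
    · cases w using List.reverseRecOn with
      | nil =>
        have := (List.append_inj' (show [] ++ [0] = v ++ [i + 1] from hwv) rfl).2
        simp at this
      | append_singleton w b =>
        cases b
        · rw [toVertex_append_false] at hwv
          have := (List.append_inj' hwv rfl).2
          simp at this
        · obtain ⟨v', j, h1, h2⟩ := exists_toVertex_append_true w
          obtain ⟨rfl, h3⟩ := List.append_inj' (h2.symm.trans hwv) rfl
          obtain rfl : j = i := by simpa using h3
          exact h1 ▸ toVertex_mem_planeTree.2 (hS _ _ hw)

theorem IsPlaneTree.exists_planeTree_eq {T : Set Vertex} (hT : IsPlaneTree T) :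
    ∃ S, IsParentClosed S ∧ planeTree S = T := by
  refine ⟨toVertex ⁻¹' T, fun w b h => ?_, ?_⟩
  · cases b
    · rw [Set.mem_preimage, toVertex_append_false] at h
      exact hT.parent_mem _ _ h
    · obtain ⟨v, i, h1, h2⟩ := exists_toVertex_append_true w
      rw [Set.mem_preimage, h2] at h
      exact Set.mem_preimage.2 (h1 ▸ hT.sibling_mem _ _ h)
  · ext v
    cases v with
    | nil => exact ⟨fun _ => hT.root_mem, fun _ => Set.mem_insert _ _⟩
    | cons a v =>
      obtain ⟨w, hw⟩ := exists_toVertex_eq a v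
      rw [← hw, toVertex_mem_planeTree]
      rfl

theorem planeTreesOfSize_succ (n : ℕ) : planeTreesOfSize (n + 1) =
    (fun t => planeTree (nodes t)) '' (BinaryTree.treesOfNumNodesEq n : Set (BinaryTree Unit)) := by
  ext T
  constructor
  · rintro ⟨hT, hcard⟩
    obtain ⟨S, hS, rfl⟩ := hT.exists_planeTree_eq
    rw [encard_planeTree] at hcard
    have hcard' : S.encard = n := by
      push_cast at hcard
      exact (ENat.add_left_injective_of_ne_top ENat.one_ne_top) hcard
    obtain ⟨t, rfl⟩ := exists_nodes_eq hS (Set.finite_of_encard_eq_coe hcard')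
    refine ⟨t, BinaryTree.mem_treesOfNumNodesEq.2 ?_, rfl⟩
    rw [encard_nodes] at hcard'
    exact_mod_cast hcard'
  · rintro ⟨t, ht, rfl⟩
    refine ⟨isPlaneTree_planeTree (isParentClosed_nodes t), ?_⟩
    dsimp only
    rw [encard_planeTree, encard_nodes, BinaryTree.mem_treesOfNumNodesEq.1 ht]
    norm_cast

theorem isParentClosed_rankTree (p : ℝ) (r : ℕ∞) (ω : BinaryEnv) :
    IsParentClosed (rankTree p r ω) := by
  intro w b h h0
  refine h ?_
  rw [rank_append, h0, rank_zero]

theorem infinite_rankTree_top {p : ℝ} (hp : 1 / 2 < p) (hp1 : p ≤ 1) (ω : BinaryEnv) :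
    (rankTree p ⊤ ω).Infinite := by
  -- Descending always into an infinite subtree gives one node at every depth.
  have h (n : ℕ) : ∃ w : List Bool, w.length = n ∧ rank p w ⊤ ω = ⊤ := by
    induction n with
    | zero => exact ⟨[], rfl, rfl⟩
    | succ n ih =>
      obtain ⟨w, hw, hr⟩ := ih
      obtain ⟨b, hb⟩ := exists_childRank_top hp hp1 (ω w)
      refine ⟨w ++ [b], by simp [hw], ?_⟩
      rw [rank_append, hr, rank, rank, List.append_nil, hb]
  choose w hw hr using h
  refine Set.infinite_of_injective_forall_mem (f := w) (fun m n hmn => ?_) fun n => ?_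
  · rw [← hw m, hmn, hw n]
  · rw [rankTree, Set.mem_ofPred_eq, hr]
    exact ENat.top_ne_zero

/-! ### Uniformity of the finite trees -/

/-- The atoms make μ dominate the uniform law, and two probability measures that are comparable
coincide. -/
theorem eq_uniformOn_of_inv_card_le {α : Type*} [MeasurableSpace α] [MeasurableSingletonClass α]
    {μ : Measure α} [IsProbabilityMeasure μ] {A : Finset α} (hA : A.Nonempty)
    (h : ∀ a ∈ A, (A.card : ℝ≥0∞)⁻¹ ≤ μ {a}) : μ = uniformOn (A : Set α) := by
  classical
  have := isProbabilityMeasure_uniformOn A.finite_toSet (Finset.coe_nonempty.2 hA)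
  refine (Measure.eq_of_le_of_isProbabilityMeasure (Measure.le_intro fun s hs _ => ?_)).symm
  have hs' : (A : Set α) ∩ s = (A.filter (· ∈ s) : Finset α) := by
    ext a
    simp
  rw [uniformOn, cond_apply A.measurableSet, hs', Measure.count_apply_finset,
    Measure.count_apply_finset]
  calc (A.card : ℝ≥0∞)⁻¹ * (A.filter (· ∈ s)).card
      = ∑ a ∈ A.filter (· ∈ s), (A.card : ℝ≥0∞)⁻¹ := by
        rw [Finset.sum_const, nsmul_eq_mul, mul_comm]
    _ ≤ ∑ a ∈ A.filter (· ∈ s), μ {a} :=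
        Finset.sum_le_sum fun a ha => h a (Finset.mem_filter.1 ha).1
    _ = μ (A.filter (· ∈ s) : Finset α) := sum_measure_singleton
    _ ≤ μ s := measure_mono (hs' ▸ Set.inter_subset_right)

/-- The random rooted ordered tree that corresponds to `rankTree p r`. -/
def rankPlaneTree (p : ℝ) (r : ℕ∞) (ω : BinaryEnv) : Set Vertex := planeTree (rankTree p r ω)

theorem measurable_rankPlaneTree (p : ℝ) (r : ℕ∞) : Measurable (rankPlaneTree p r) :=
  measurable_planeTree.comp (measurable_rankTree p r)

theorem map_rankPlaneTree {p : ℝ} (hp : 1 / 2 < p) (hp1 : p ≤ 1) (n : ℕ) :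
    binaryEnvLaw.map (rankPlaneTree p n) = uniformTreeLaw (n + 1) := by
  classical
  have hcoe : planeTreesOfSize (n + 1) = ((BinaryTree.treesOfNumNodesEq n).image
      fun t => planeTree (nodes t) : Finset (Set Vertex)) := by
    rw [planeTreesOfSize_succ, Finset.coe_image]
  have hcard : ((BinaryTree.treesOfNumNodesEq n).image fun t => planeTree (nodes t)).card =
      catalan n := by
    rw [Finset.card_image_of_injective _ (f := fun t => planeTree (nodes t))
      (planeTree_injective.comp nodes_injective),
      BinaryTree.treesOfNumNodesEq_card_eq_catalan]
  have := Measure.isProbabilityMeasure_map (μ := binaryEnvLaw)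
    (measurable_rankPlaneTree p n).aemeasurable
  rw [uniformTreeLaw, hcoe]
  refine eq_uniformOn_of_inv_card_le (Finset.card_pos.1 (hcard ▸ catalan_pos n)) fun T hT => ?_
  rw [hcard]
  obtain ⟨t, ht, rfl⟩ := Finset.mem_image.1 hT
  rw [← BinaryTree.mem_treesOfNumNodesEq.1 ht,
    Measure.map_apply (measurable_rankPlaneTree p _) (measurableSet_singleton _)]
  refine (inv_catalan_le_binaryEnvLaw hp hp1 t).trans (measure_mono fun ω hω => ?_)
  exact congrArg planeTree hω

/-! ### Containment probabilities of the Galton–Watson tree -/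

theorem nil_mem_familyTree (X : Vertex → ℕ) : [] ∈ familyTree X :=
  Set.mem_iUnion.2 ⟨0, rfl⟩

theorem append_mem_familyTree {X : Vertex → ℕ} {v : Vertex} {i : ℕ} :
    v ++ [i] ∈ familyTree X ↔ v ∈ familyTree X ∧ i < X v := by
  simp only [familyTree, Set.mem_iUnion]
  constructor
  · rintro ⟨_ | n, hn⟩
    · simp [generation] at hn
    · obtain ⟨v', hv', i', hi', h⟩ := hn
      obtain ⟨rfl, h2⟩ := List.append_inj' h rfl
      obtain rfl : i = i' := by simpa using h2
      exact ⟨⟨n, hv'⟩, hi'⟩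
  · rintro ⟨⟨n, hn⟩, hi⟩
    exact ⟨n + 1, v, hn, i, hi, rfl⟩

theorem isPlaneTree_familyTree (X : Vertex → ℕ) : IsPlaneTree (familyTree X) where
  root_mem := nil_mem_familyTree X
  parent_mem _ _ h := (append_mem_familyTree.1 h).1
  sibling_mem _ _ h := append_mem_familyTree.2
    ⟨(append_mem_familyTree.1 h).1, (Nat.lt_succ_self _).trans (append_mem_familyTree.1 h).2⟩

theorem IsPlaneTree.subset_familyTree_iff {F : Set Vertex} (hF : IsPlaneTree F) {X : Vertex → ℕ} :
    F ⊆ familyTree X ↔ ∀ v i, v ++ [i] ∈ F → i < X v := by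
  refine ⟨fun h v i hv => (append_mem_familyTree.1 (h hv)).2, fun h v hv => ?_⟩
  induction v using List.reverseRecOn with
  | nil => exact nil_mem_familyTree X
  | append_singleton v i ih =>
    exact append_mem_familyTree.2 ⟨ih (hF.parent_mem _ _ hv), h _ _ hv⟩

theorem IsPlaneTree.mem_of_le {F : Set Vertex} (hF : IsPlaneTree F) {v : Vertex} {i j : ℕ}
    (hij : i ≤ j) (h : v ++ [j] ∈ F) : v ++ [i] ∈ F := by
  induction j, hij using Nat.le_induction with
  | base => exact h
  | succ j _ ih => exact ih (hF.sibling_mem _ _ h)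

/-- The number of children of the vertices of a finite tree. -/
theorem IsPlaneTree.exists_numChildren {F : Set Vertex} (hF : IsPlaneTree F) (hfin : F.Finite) :
    ∃ m : Vertex → ℕ, ∀ v i, v ++ [i] ∈ F ↔ i < m v := by
  classical
  have h (v : Vertex) : ∃ m, v ++ [m] ∉ F := by
    by_contra! hall
    refine Set.infinite_of_injective_forall_mem (f := fun i => v ++ [i]) (fun i j hij => ?_)
      hall hfin
    simpa using hij
  refine ⟨fun v => Nat.find (h v), fun v i => ⟨fun hi => ?_, fun hi => ?_⟩⟩
  · by_contra! hle
    exact Nat.find_spec (h v) (hF.mem_of_le hle hi)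
  · exact not_not.1 (Nat.find_min (h v) hi)

/-- Every vertex except the root is counted once, at its parent. -/
theorem IsPlaneTree.sum_numChildren {F : Finset Vertex} (hF : IsPlaneTree (F : Set Vertex))
    {m : Vertex → ℕ} (hm : ∀ v i, v ++ [i] ∈ F ↔ i < m v) : ∑ v ∈ F, m v + 1 = F.card := by
  have h0 : [] ∈ F := hF.root_mem
  rw [← Finset.card_erase_add_one h0, Finset.card_eq_sum_card_fiberwise (f := List.dropLast)
    (t := F)]
  · congr 1
    refine Finset.sum_congr rfl fun v hv => ?_
    have : {a ∈ F.erase [] | a.dropLast = v} = (Finset.range (m v)).image fun i => v ++ [i] := by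
      ext u
      simp only [Finset.mem_filter, Finset.mem_erase, Finset.mem_image, Finset.mem_range]
      constructor
      · rintro ⟨⟨hu, huF⟩, rfl⟩
        have := List.dropLast_append_getLast hu
        exact ⟨u.getLast hu, (hm _ _).1 (this.symm ▸ huF), this⟩
      · rintro ⟨i, hi, rfl⟩
        exact ⟨⟨by simp, (hm _ _).2 hi⟩, by simp⟩
    rw [this, Finset.card_image_of_injective, Finset.card_range]
    intro i j hij
    simpa using hij
  · intro u hu
    obtain ⟨hu0, huF⟩ := Finset.mem_erase.1 (Finset.mem_coe.1 hu)
    refine hF.parent_mem u.dropLast (u.getLast hu0) ?_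
    rwa [List.dropLast_append_getLast hu0]

theorem offspringLaw_Ici {p : ℝ} (hp : 0 ≤ p) (hp1 : p < 1) (m : ℕ) :
    offspringLaw p (Set.Ici m) = ENNReal.ofReal (p ^ m) := by
  have h (k : ℕ) : (ENNReal.ofReal (p ^ k * (1 - p)) • Measure.dirac k) (Set.Ici m) =
      if m ≤ k then ENNReal.ofReal (p ^ k * (1 - p)) else 0 := by
    simp [Set.indicator_apply]
  rw [offspringLaw, Measure.sum_apply _ .of_discrete, tsum_congr h,
    ← Summable.sum_add_tsum_nat_add' (k := m) ENNReal.summable,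
    Finset.sum_eq_zero fun k hk => if_neg (by simpa using hk), zero_add]
  have h2 (k : ℕ) : (if m ≤ k + m then ENNReal.ofReal (p ^ (k + m) * (1 - p)) else 0) =
      ENNReal.ofReal (p ^ m * (1 - p) * p ^ k) := by
    rw [if_pos (Nat.le_add_left _ _), pow_add]
    congr 1
    ring
  have h1p : 0 ≤ 1 - p := by linarith
  have hs := (hasSum_geometric_of_lt_one hp hp1).mul_left (p ^ m * (1 - p))
  rw [tsum_congr h2, ← ENNReal.ofReal_tsum_of_nonneg (fun k => by positivity) hs.summable,
    hs.tsum_eq]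
  congr 1
  have : 1 - p ≠ 0 := by linarith
  field_simp

theorem isProbabilityMeasure_offspringLaw {p : ℝ} (hp : 0 ≤ p) (hp1 : p < 1) :
    IsProbabilityMeasure (offspringLaw p) := by
  refine ⟨?_⟩
  have h := offspringLaw_Ici hp hp1 0
  rwa [pow_zero, ENNReal.ofReal_one, show Set.Ici 0 = Set.univ from Set.Ici_bot] at h

/-- Containing F means that each v in F has at least as many children as in F. These events are
independent with probabilities p ^ m_v, and the m_v add up to |F| - 1. -/
theorem galtonWatsonLaw_superset {p : ℝ} (hp : 0 ≤ p) (hp1 : p < 1) {F : Finset Vertex}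
    (hF : IsPlaneTree (F : Set Vertex)) :
    galtonWatsonLaw p {T | (F : Set Vertex) ⊆ T} = ENNReal.ofReal (p ^ (F.card - 1)) := by
  have := isProbabilityMeasure_offspringLaw hp hp1
  obtain ⟨m, hm⟩ := hF.exists_numChildren F.finite_toSet
  have hset : familyTree ⁻¹' {T | (F : Set Vertex) ⊆ T} = Set.pi F fun v => Set.Ici (m v) := by
    ext X
    simp only [Set.mem_preimage, Set.mem_ofPred_eq, hF.subset_familyTree_iff, hm, Set.mem_pi,
      Set.mem_Ici]
    constructor
    · intro h v _
      by_contra! hlt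
      exact lt_irrefl _ (h v _ hlt)
    · intro h v i hi
      exact hi.trans_le (h v (hF.parent_mem v i ((hm v i).2 hi)))
  rw [galtonWatsonLaw, Measure.map_apply measurable_familyTree (measurableSet_superset _), hset,
    Measure.infinitePi_pi _ fun _ _ => measurableSet_Ici]
  simp_rw [offspringLaw_Ici hp hp1]
  rw [← ENNReal.ofReal_prod_of_nonneg fun _ _ => by positivity, Finset.prod_pow_eq_pow_sum,
    ← hF.sum_numChildren (by simpa using hm), Nat.add_sub_cancel]

theorem finite_nodes (t : BinaryTree Unit) : (nodes t).Finite :=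
  Set.finite_of_encard_eq_coe (encard_nodes t)

theorem galtonWatsonLaw_planeTree_subset {p : ℝ} (hp : 0 ≤ p) (hp1 : p < 1)
    (t : BinaryTree Unit) :
    galtonWatsonLaw p {T | planeTree (nodes t) ⊆ T} = ENNReal.ofReal (p ^ t.numNodes) := by
  have hfin : (planeTree (nodes t)).Finite := ((finite_nodes t).image _).insert _
  have hF : IsPlaneTree (hfin.toFinset : Set Vertex) := by
    rw [hfin.coe_toFinset]
    exact isPlaneTree_planeTree (isParentClosed_nodes t)
  have h := galtonWatsonLaw_superset hp hp1 hF
  rw [hfin.coe_toFinset] at h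
  have hcard := encard_planeTree (nodes t)
  rw [encard_nodes, hfin.encard_eq_coe_toFinset_card] at hcard
  have hcard' : hfin.toFinset.card = t.numNodes + 1 := by exact_mod_cast hcard
  rw [h, hcard', Nat.add_sub_cancel]

/-! ### Identification of the infinite tree -/

/-- The law of a random set is determined by the probabilities to contain given finite sets. -/
theorem ext_of_superset {α : Type*} [Countable α] {μ ν : Measure (Set α)}
    [IsFiniteMeasure μ] (h : ∀ F : Finset α, μ {S | (F : Set α) ⊆ S} = ν {S | (F : Set α) ⊆ S}) :
    μ = ν := by
  classical
  refine ext_of_generate_finite (Set.range fun F : Finset α => {S : Set α | (F : Set α) ⊆ S})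
    (le_antisymm ?_ ?_) ?_ ?_ ?_
  · set m : MeasurableSpace (Set α) := MeasurableSpace.generateFrom
      (Set.range fun F : Finset α => {S : Set α | (F : Set α) ⊆ S})
    have hid : @Measurable (Set α) (Set α) m Set.instMeasurableSpace id := by
      refine (@measurable_set_iff _ _ m id).2 fun a => (@measurableSet_setOfPred _ m _).1
        (MeasurableSpace.measurableSet_generateFrom ⟨{a}, ?_⟩)
      ext S
      simp
    exact fun s hs => hid hs
  · refine MeasurableSpace.generateFrom_le ?_
    rintro _ ⟨F, rfl⟩
    exact measurableSet_superset _
  · rintro _ ⟨F, rfl⟩ _ ⟨G, rfl⟩ _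
    refine ⟨F ∪ G, ?_⟩
    ext S
    simp
  · rintro _ ⟨F, rfl⟩
    exact h F
  · simpa using h ∅

/-- The smallest rooted ordered tree that contains a given finite set. -/
theorem exists_planeTree_subset_iff (F : Finset Vertex) : ∃ t : BinaryTree Unit,
    ∀ T, IsPlaneTree T → ((F : Set Vertex) ⊆ T ↔ planeTree (nodes t) ⊆ T) := by
  -- The prefixes of the codes of the vertices in F form the least parent-closed set that must be
  -- present; the plane root has no code and is always there.
  set A : Set (List Bool) := {w | ∃ u, toVertex (w ++ u) ∈ F} with hA
  have hcl : IsParentClosed A := fun w b ⟨u, hu⟩ => ⟨b :: u, by simpa using hu⟩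
  have hfin : A.Finite := by
    have h1 : (toVertex ⁻¹' (F : Set Vertex)).Finite :=
      F.finite_toSet.preimage toVertex_injective.injOn
    refine (h1.biUnion fun w _ => (w.inits.finite_toSet)).subset ?_
    rintro w ⟨u, hu⟩
    exact Set.mem_biUnion (x := w ++ u) hu ((List.mem_inits _ _).2 (List.prefix_append w u))
  obtain ⟨t, ht⟩ := exists_nodes_eq hcl hfin
  refine ⟨t, fun T hT => ?_⟩
  obtain ⟨S, hS, rfl⟩ := hT.exists_planeTree_eq
  rw [planeTree_subset_iff, ht]
  constructor
  · rintro h w ⟨u, hu⟩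
    exact hS.append (toVertex_mem_planeTree.1 (h hu))
  · intro h v hv
    cases v with
    | nil => exact hT.root_mem
    | cons a v =>
      obtain ⟨w, hw⟩ := exists_toVertex_eq a v
      rw [← hw, toVertex_mem_planeTree]
      exact h ⟨[], by rwa [List.append_nil, hw]⟩

/-- A plane tree contains a finite set exactly when it contains the plane tree generated by it, so
testing on finite plane trees suffices. -/
theorem ext_of_planeTree_subset {μ ν : Measure (Set Vertex)} [IsFiniteMeasure μ]
    (hμ : ∀ᵐ T ∂μ, IsPlaneTree T) (hν : ∀ᵐ T ∂ν, IsPlaneTree T)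
    (h : ∀ t, μ {T | planeTree (nodes t) ⊆ T} = ν {T | planeTree (nodes t) ⊆ T}) : μ = ν := by
  refine ext_of_superset fun F => ?_
  obtain ⟨t, ht⟩ := exists_planeTree_subset_iff F
  have key {κ : Measure (Set Vertex)} (hκ : ∀ᵐ T ∂κ, IsPlaneTree T) :
      κ {T | (F : Set Vertex) ⊆ T} = κ {T | planeTree (nodes t) ⊆ T} :=
    measure_congr (by filter_upwards [hκ] with T hT using propext (ht T hT))
  rw [key hμ, key hν, h]

theorem measurableSet_isPlaneTree : MeasurableSet {T : Set Vertex | IsPlaneTree T} := by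
  have : {T : Set Vertex | IsPlaneTree T} = {T | [] ∈ T} ∩
      ((⋂ (v : Vertex) (i : ℕ), {T | v ++ [i] ∈ T}ᶜ ∪ {T | v ∈ T}) ∩
        ⋂ (v : Vertex) (i : ℕ), {T | v ++ [i + 1] ∈ T}ᶜ ∪ {T | v ++ [i] ∈ T}) := by
    ext T
    simp only [Set.mem_inter_iff, Set.mem_iInter, Set.mem_union, Set.mem_compl_iff,
      Set.mem_ofPred_eq, ← imp_iff_not_or]
    exact ⟨fun h => ⟨h.1, h.2, h.3⟩, fun h => ⟨h.1, h.2.1, h.2.2⟩⟩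
  rw [this]
  refine (measurableSet_mem _).inter (.inter ?_ ?_) <;>
  exact .iInter fun v => .iInter fun i => (measurableSet_mem _).compl.union (measurableSet_mem _)

/-- The Galton–Watson tree is a mixture of the trees `rankPlaneTree p r`. -/
theorem galtonWatsonLaw_eq {p : ℝ} (hp : 1 / 2 < p) (hp1 : p < 1) :
    galtonWatsonLaw p =
      (Measure.sum fun n : ℕ =>
        ENNReal.ofReal (sizeMass p n) • binaryEnvLaw.map (rankPlaneTree p n)) +
      ENNReal.ofReal ((2 * p - 1) / p) • binaryEnvLaw.map (rankPlaneTree p ⊤) := by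
  have hp0 : 0 ≤ p := by linarith
  have := isProbabilityMeasure_offspringLaw hp0 hp1
  have : IsFiniteMeasure (galtonWatsonLaw p) := by unfold galtonWatsonLaw; infer_instance
  have hplane (r : ℕ∞) : ∀ᵐ T ∂binaryEnvLaw.map (rankPlaneTree p r), IsPlaneTree T :=
    (ae_map_iff (measurable_rankPlaneTree p r).aemeasurable measurableSet_isPlaneTree).2
      (.of_forall fun ω => isPlaneTree_planeTree (isParentClosed_rankTree p r ω))
  refine ext_of_planeTree_subset ?_ ?_ fun t => ?_
  · exact (ae_map_iff measurable_familyTree.aemeasurable measurableSet_isPlaneTree).2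
      (.of_forall isPlaneTree_familyTree)
  · rw [ae_add_measure_iff, Measure.ae_sum_iff' measurableSet_isPlaneTree]
    exact ⟨fun n => Measure.ae_smul_measure (hplane n) _, Measure.ae_smul_measure (hplane ⊤) _⟩
  · rw [galtonWatsonLaw_planeTree_subset hp0 hp1, ← tsum_sizeMass_mul_binaryEnvLaw hp hp1.le t,
      Measure.add_apply, Measure.sum_apply _ (measurableSet_superset _)]
    simp only [Measure.smul_apply, smul_eq_mul,
      Measure.map_apply (measurable_rankPlaneTree p _) (measurableSet_superset _),
      Set.preimage_ofPred_eq, rankPlaneTree, planeTree_subset_iff]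

theorem ae_finite_uniformTreeLaw (k : ℕ) : ∀ᵐ T ∂uniformTreeLaw k, T.Finite := by
  have h : ∀ᵐ T ∂uniformTreeLaw k, T ∈ planeTreesOfSize k := by
    have hm : MeasurableSet (planeTreesOfSize k) :=
      (Set.Countable.ofPred_finite.mono fun T hT =>
        Set.finite_of_encard_eq_coe hT.2).measurableSet
    exact Measure.ae_smul_measure (ae_restrict_mem hm) _
  filter_upwards [h] with T hT using Set.finite_of_encard_eq_coe hT.2

/-- The law of `T_∞(p)`. -/
theorem map_rankPlaneTree_top {p : ℝ} (hp : 1 / 2 < p) (hp1 : p < 1) :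
    binaryEnvLaw.map (rankPlaneTree p ⊤) = supercriticalInfiniteTreeLaw p := by
  have hm : MeasurableSet {T : Set Vertex | T.Infinite} := MeasurableSet.setOfPred_infinite
  -- Restricting the mixture to infinite trees removes every finite-size component and keeps the one
  -- for ⊤ intact; its weight (2p - 1)/p is then the normalising constant.
  have hfin (n : ℕ) : (binaryEnvLaw.map (rankPlaneTree p n)).restrict {T | T.Infinite} = 0 := by
    rw [map_rankPlaneTree hp hp1.le, Measure.restrict_eq_zero]
    have := ae_finite_uniformTreeLaw (n + 1)
    rwa [ae_iff] at this
  have htop : (binaryEnvLaw.map (rankPlaneTree p ⊤)).restrict {T | T.Infinite} =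
      binaryEnvLaw.map (rankPlaneTree p ⊤) := by
    refine Measure.restrict_eq_self_of_ae_mem
      ((ae_map_iff (measurable_rankPlaneTree p ⊤).aemeasurable hm).2 (.of_forall fun ω => ?_))
    exact ((infinite_rankTree_top hp hp1.le ω).image toVertex_injective.injOn).mono
      (Set.subset_insert _ _)
  have hr : (galtonWatsonLaw p).restrict {T | T.Infinite} =
      ENNReal.ofReal ((2 * p - 1) / p) • binaryEnvLaw.map (rankPlaneTree p ⊤) := by
    rw [galtonWatsonLaw_eq hp hp1, Measure.restrict_add, Measure.restrict_sum _ hm]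
    simp_rw [Measure.restrict_smul, hfin, htop]
    simp
  have := Measure.isProbabilityMeasure_map (μ := binaryEnvLaw)
    (measurable_rankPlaneTree p ⊤).aemeasurable
  have hmass : galtonWatsonLaw p {T | T.Infinite} = ENNReal.ofReal ((2 * p - 1) / p) := by
    rw [← Measure.restrict_apply_univ, hr, Measure.smul_apply, measure_univ, smul_eq_mul, mul_one]
  have hpos : 0 < (2 * p - 1) / p := div_pos (by linarith) (by linarith)
  rw [supercriticalInfiniteTreeLaw, if_neg hp1.ne, ProbabilityTheory.cond, hr, hmass, smul_smul,
    ENNReal.inv_mul_cancel (ENNReal.ofReal_pos.2 hpos).ne' ENNReal.ofReal_ne_top, one_smul]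

/-! ### Increasing couplings and the law of their union -/

/-- The shift to k - 1 appears because the plane root is not a node of the binary tree. -/
theorem isIncreasingUniformCoupling_rankPlaneTree {p : ℝ} (hp : 1 / 2 < p) (hp1 : p ≤ 1) :
    IsIncreasingUniformCoupling binaryEnvLaw fun k => rankPlaneTree p (k - 1 : ℕ) where
  isProbabilityMeasure := inferInstance
  hasLaw k hk := by
    obtain ⟨n, rfl⟩ := Nat.exists_eq_add_of_le' hk
    exact ⟨(measurable_rankPlaneTree p _).aemeasurable, map_rankPlaneTree hp hp1 n⟩
  subset_succ := .of_forall fun ω k _ => planeTree_subset_iff.2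
    (rankTree_mono hp hp1 (by norm_cast; omega) ω)

/-- The finite-dimensional probabilities of the union of an increasing coupling are the limits of
those of the uniform trees. -/
theorem IsIncreasingUniformCoupling.tendsto {Ω : Type*} [MeasurableSpace Ω] {P : Measure Ω}
    {T : ℕ → Ω → Set Vertex} (h : IsIncreasingUniformCoupling P T) {ν : Measure (Set Vertex)}
    (hν : HasLaw (fun ω => ⋃ k : ℕ, ⋃ _ : 1 ≤ k, T k ω) ν P) (F : Finset Vertex) :
    Filter.Tendsto (fun k => uniformTreeLaw (k + 1) {S | (F : Set Vertex) ⊆ S}) Filter.atTop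
      (nhds (ν {S | (F : Set Vertex) ⊆ S})) := by
  have := h.isProbabilityMeasure
  rw [← hν.map_eq, Measure.map_apply_of_aemeasurable hν.aemeasurable (measurableSet_superset _)]
  have hk (k : ℕ) : uniformTreeLaw (k + 1) {S | (F : Set Vertex) ⊆ S} =
      P {ω | (F : Set Vertex) ⊆ T (k + 1) ω} := by
    rw [← (h.hasLaw (k + 1) (by omega)).map_eq, Measure.map_apply_of_aemeasurable
      (h.hasLaw (k + 1) (by omega)).aemeasurable (measurableSet_superset _)]
    rfl
  simp_rw [hk]
  -- On this almost sure event the trees increase, so a finite F lies in the union exactly when it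
  -- lies in some T_k; continuity from below then gives the limit.
  set G : Set Ω := {ω | ∀ k : ℕ, 1 ≤ k → T k ω ⊆ T (k + 1) ω} with hG
  have hmono (ω : Ω) (hω : ω ∈ G) : Monotone fun k => T (k + 1) ω :=
    monotone_nat_of_le_succ fun k => hω (k + 1) (by omega)
  have hinter (A : Set Ω) : P A = P (A ∩ G) :=
    (measure_inter_conull h.subset_succ).symm
  simp_rw [hinter {ω | (F : Set Vertex) ⊆ T (_ + 1) ω}]
  rw [hinter]
  have hunion : (fun ω => ⋃ k : ℕ, ⋃ _ : 1 ≤ k, T k ω) ⁻¹' {S | (F : Set Vertex) ⊆ S} ∩ G =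
      ⋃ k : ℕ, {ω | (F : Set Vertex) ⊆ T (k + 1) ω} ∩ G := by
    ext ω
    simp only [Set.mem_inter_iff, Set.mem_preimage, Set.mem_ofPred_eq, Set.mem_iUnion]
    constructor
    · rintro ⟨hF, hω⟩
      obtain ⟨k, hk⟩ := (hmono ω hω).directed_le.exists_mem_subset_of_finset_subset_biUnion
        (s := F) (hF.trans (Set.iUnion₂_subset fun k hk => by
          obtain ⟨n, rfl⟩ := Nat.exists_eq_add_of_le' hk
          exact Set.subset_iUnion (fun n => T (n + 1) ω) n))
      exact ⟨k, hk, hω⟩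
    · rintro ⟨k, hk, hω⟩
      exact ⟨hk.trans (Set.subset_iUnion₂ (s := fun k (_ : 1 ≤ k) => T k ω) (k + 1) (by omega)),
        hω⟩
  rw [hunion]
  exact tendsto_measure_iUnion_atTop fun k l hkl ω hω =>
    ⟨hω.1.trans (hmono ω hω.2 hkl), hω.2⟩

/-- The law of the union of an increasing coupling does not depend on the coupling. -/
theorem IsCriticalInfiniteTreeLaw.unique {ν ν' : Measure (Set Vertex)}
    (h : IsCriticalInfiniteTreeLaw ν) (h' : IsCriticalInfiniteTreeLaw ν') : ν = ν' := by
  obtain ⟨Ω, _, P, T, hT, hν⟩ := h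
  obtain ⟨Ω', _, P', T', hT', hν'⟩ := h'
  have := hT.isProbabilityMeasure
  have : IsProbabilityMeasure ν := hν.isProbabilityMeasure_iff.1 inferInstance
  exact ext_of_superset fun F => tendsto_nhds_unique (hT.tendsto hν F) (hT'.tendsto hν' F)

end GeomTree

open GeomTree in
theorem theorem3p1 (p : ℝ) (hp : 1 / 2 < p) (hp1 : p ≤ 1) :
    (∃ ν : Measure (Set Vertex), IsCriticalInfiniteTreeLaw ν) ∧
    ∀ ν : Measure (Set Vertex), IsCriticalInfiniteTreeLaw ν →
      ∃ (Ω : Type) (_ : MeasurableSpace Ω) (P : Measure Ω) (T₁ T₂ : Ω → Set Vertex),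
        IsProbabilityMeasure P ∧
        HasLaw T₁ ν P ∧
        HasLaw T₂ (supercriticalInfiniteTreeLaw p) P ∧
        ∀ᵐ ω ∂P, T₁ ω ⊆ T₂ ω := by
  set U : BinaryEnv → Set Vertex :=
    fun ω => ⋃ k : ℕ, ⋃ _ : 1 ≤ k, rankPlaneTree p (k - 1 : ℕ) ω with hU
  have hUm : Measurable U := by
    refine measurable_set_iff.2 fun v => ?_
    simp only [hU, Set.mem_iUnion, exists_prop]
    exact .exists fun k => measurable_const.and
      (measurable_set_iff.1 (measurable_rankPlaneTree p _) v)
  have hcoupling := isIncreasingUniformCoupling_rankPlaneTree hp hp1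
  have hcrit : IsCriticalInfiniteTreeLaw (binaryEnvLaw.map U) :=
    ⟨BinaryEnv, inferInstance, binaryEnvLaw, _, hcoupling, hUm.aemeasurable, rfl⟩
  refine ⟨⟨_, hcrit⟩, fun ν hν => ?_⟩
  obtain rfl := hν.unique hcrit
  -- At p = 1 the target law is by definition the point mass at the full tree, so the constant tree
  -- is used; the identification of the law for ⊤ requires p < 1.
  refine ⟨BinaryEnv, inferInstance, binaryEnvLaw, U,
    if p = 1 then fun _ => Set.univ else rankPlaneTree p ⊤, inferInstance,
    ⟨hUm.aemeasurable, rfl⟩, ?_, ?_⟩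
  · obtain rfl | hlt := hp1.eq_or_lt
    · rw [if_pos rfl, supercriticalInfiniteTreeLaw, if_pos rfl]
      exact ⟨aemeasurable_const, by simp [Measure.map_const]⟩
    · rw [if_neg hlt.ne]
      exact ⟨(measurable_rankPlaneTree p ⊤).aemeasurable, map_rankPlaneTree_top hp hlt⟩
  · refine .of_forall fun ω => ?_
    split_ifs
    · exact Set.subset_univ _
    · exact Set.iUnion₂_subset fun k _ => planeTree_subset_iff.2 (rankTree_mono hp hp1 le_top ω)
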